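/- Consider a network with $K$ tiers of base stations (BSs) and soft frequency reuse. Tier $j$ has BS density $\lambda_j>0$, path loss exponent $\alpha_j>2$, cell-center transmission power $P_j>0$, cell-edge to cell-center power ratio $\phi_j>0$, reuse factor $\Delta_j>1$ and optimisation factor $\epsilon_j\in[0,1]$. Put $\lambda_j^{(c)}=\frac{\Delta_j-1}{\Delta_j}\lambda_j$ and $\lambda_j^{(e)}=\frac1{\Delta_j}\lambda_j$. A typical user sits at the origin of $\mathbb R^2$ and is served, on a cell-edge resource block $b$, by a BS of tier $i$ at distance $r>0$. The other BSs of tier $j$ that use $b$ as a cell-center, respectively cell-edge, block form homogeneous Poisson point processes $\theta_j^{(c)}$, $\theta_j^{(e)}$ on $\mathbb R^2$ of densities $\lambda_j^{(c)}$, $\lambda_j^{(e)}$. Each such BS $z$ carries a channel power gain $g_z$ and an indicator $\tau_z\in\{0,1\}$ (block $b$ is occupied in the cell of $z$) with mean $\epsilon_j$. The serving link has power gain $g$. All gains have the Rayleigh–lognormal law, that is, the law of $E\cdot 10^{S/10}$ with $E$ exponential of mean $1$ and $S\sim\mathcal N(\mu_z,\sigma_z^2)$ independent, $\sigma_z>0$.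 The $2K$ point processes, all gains and all indicators are mutually independent. With noise power $\sigma^2\ge 0$, let $$I=\sum_{j=1}^K\Big(\sum_{z\in\theta_j^{(c)}}\tau_zP_jg_z|z|^{-\alpha_j}+\sum_{z\in\theta_j^{(e)}}\tau_z\phi_jP_jg_z|z|^{-\alpha_j}\Big),\qquad \mathrm{SINR}_i=\frac{\phi_iP_i\,g\,r^{-\alpha_i}}{I+\sigma^2},\qquad \frac1{\mathrm{SNR}_i}=\frac{\sigma^2}{P_i}.$$ For a threshold $\hat T>0$ let $\mathbb P_i^{(e)}(\hat T,\phi_i\mid r)$ be the probability of $\mathrm{SINR}_i\ge\hat T$ conditional on the event that no other BS is at distance less than $r$ from the user (so that the serving BS is the nearest one). Let $\gamma(t)=10^{(\sqrt2\sigma_zt+\mu_z)/10}$ and, for $q>0$ and $t,s\in\mathbb R$, $$C=C_{i,j}(q,t,s)=\hat T\,\frac{\gamma(s)}{\gamma(t)}\,\frac{qP_j}{\phi_iP_i}\,r^{\alpha_i-\alpha_j},\qquad A_j(C)=\frac{2\pi C^{2/\alpha_j}}{\alpha_j\sin\big(\frac{\pi(\alpha_j-2)}{\alpha_j}\big)}.$$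 (1) Exact formula: $$\mathbb P_i^{(e)}(\hat T,\phi_i\mid r)=\int_{\mathbb R}\frac{e^{-t^2}}{\sqrt\pi}\exp\Big[-\frac{\hat T r^{\alpha_i}}{\gamma(t)}\frac1{\phi_i\mathrm{SNR}_i}\Big]\exp\Big[-\pi r^2\sum_{j=1}^K\epsilon_j\big(\lambda_j^{(c)}f_{i,j}(1,t)+\lambda_j^{(e)}f_{i,j}(\phi_j,t)\big)\Big]dt,$$ $$f_{i,j}(q,t)=\int_{\mathbb R}\frac{e^{-s^2}}{\sqrt\pi}\Big[A_j(C)-\int_0^1\frac{C}{C+u^{\alpha_j/2}}\,du\Big]ds,\qquad C=C_{i,j}(q,t,s).$$ (2) Quadrature formula: let $(a_n,\omega_n)_{n\le N_H}$ be the nodes and weights of the $N_H$-point Gauss–Hermite rule (weight $e^{-t^2}$ on $\mathbb R$) and $(x_m,c_m)_{m\le N_L}$ those of the $N_L$-point Gauss–Legendre rule (weight $1$ on $[-1,1]$). Then, as $N_H,N_L\to\infty$ jointly, the expression $$\sum_{n=1}^{N_H}\frac{\omega_n}{\sqrt\pi}\exp\Big[-\frac{\hat T r^{\alpha_i}}{\gamma(a_n)}\frac1{\phi_i\mathrm{SNR}_i}\Big]\exp\Big[-\pi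 r^2\sum_{j=1}^K\epsilon_j\big(\lambda_j^{(c)}\hat f_{i,j}(1,a_n)+\lambda_j^{(e)}\hat f_{i,j}(\phi_j,a_n)\big)\Big],$$ $$\hat f_{i,j}(q,t)=\sum_{n_1=1}^{N_H}\frac{\omega_{n_1}}{\sqrt\pi}\Big[A_j(C)-\sum_{m=1}^{N_L}\frac{c_m}2\,\frac{C}{C+\big(\frac{x_m+1}2\big)^{\alpha_j/2}}\Big],\qquad C=C_{i,j}(q,t,a_{n_1}),$$ converges to $\mathbb P_i^{(e)}(\hat T,\phi_i\mid r)$. -/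

import Mathlib

open MeasureTheory ProbabilityTheory Filter Topology
open scoped ENNReal

/-- A random sequence of points `X 0, X 1, …` (listed in some order) forms a Poisson point process
with intensity measure `Λ`: the number of points in a measurable set of finite intensity is Poisson
distributed, and the numbers of points in disjoint sets are independent. -/
structure IsPoissonProcess {Ω E : Type*} [MeasurableSpace Ω] [MeasurableSpace E]
    (μ : Measure Ω) (X : ℕ → Ω → E) (Λ : Measure E) : Prop where
  measurable : ∀ n, Measurable (X n)
  count_law : ∀ B : Set E, MeasurableSet B → Λ B ≠ ∞ → ∀ k : ℕ,
    μ {ω | {n | X n ω ∈ B}.encard = (k : ℕ∞)} =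
      ENNReal.ofReal (Real.exp (-(Λ B).toReal) * (Λ B).toReal ^ k / (k.factorial : ℝ))
  count_indep : ∀ (m : ℕ) (B : Fin m → Set E), (∀ l, MeasurableSet (B l)) →
    Pairwise (Function.onFun Disjoint B) →
    iIndepFun (fun (l : Fin m) (ω : Ω) => {n | X n ω ∈ B l}.encard) μ

/-- The lognormal shadowing gain `10 ^ ((√2 σ_z t + μ_z) / 10)` as a function of the
Gauss–Hermite variable `t` (with `μ_z`, `σ_z` in dB). -/
noncomputable def shadowGain (muz sigmaz t : ℝ) : ℝ :=
  (10 : ℝ) ^ ((√2 * sigmaz * t + muz) / 10)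

/-- The law of the Rayleigh–lognormal power gain: the product of a unit-mean exponential variable
(Rayleigh fading power) and an independent lognormal variable `10 ^ (S / 10)`, where `S` is normal
with mean `μ_z` and standard deviation `σ_z`. -/
noncomputable def rayleighLognormal (muz sigmaz : ℝ) : Measure ℝ :=
  ((expMeasure 1).prod (gaussianReal muz (Real.toNNReal (sigmaz ^ 2)))).map
    (fun p : ℝ × ℝ => p.1 * (10 : ℝ) ^ (p.2 / 10))

/-- Parameters of a `K`-tier network with soft frequency reuse. -/
structure SoftFRNetwork (K : ℕ) where
  /-- density of the base stations of each tier -/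
  lam : Fin K → ℝ
  /-- path loss exponents -/
  alpha : Fin K → ℝ
  /-- transmission powers on a cell-center resource block -/
  P : Fin K → ℝ
  /-- ratio of the transmission powers on a cell-edge and on a cell-center resource block -/
  phi : Fin K → ℝ
  /-- frequency reuse factors -/
  Delta : Fin K → ℝ
  /-- optimisation factors: probability that the resource block is occupied in an interfering cell -/
  eps : Fin K → ℝ
  /-- mean of the shadowing, in dB -/
  muz : ℝ
  /-- standard deviation of the shadowing, in dB -/
  sigmaz : ℝ
  /-- noise power `σ²` -/
  noise : ℝ
  lam_pos : ∀ j, 0 < lam j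
  alpha_gt : ∀ j, 2 < alpha j
  P_pos : ∀ j, 0 < P j
  phi_pos : ∀ j, 0 < phi j
  Delta_gt : ∀ j, 1 < Delta j
  eps_nonneg : ∀ j, 0 ≤ eps j
  eps_le : ∀ j, eps j ≤ 1
  sigmaz_pos : 0 < sigmaz
  noise_nonneg : 0 ≤ noise

/-- The two kinds of cells: those that use the given resource block as a cell-center block, and
those that use it as a cell-edge block. -/
inductive CellGroup : Type where
  | center : CellGroup
  | edge : CellGroup

namespace SoftFRNetwork

variable {K : ℕ}

/-- Density of the cells of tier `j` in the given group: `(Δ - 1) / Δ * λ` and `1 / Δ * λ`. -/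
noncomputable def density (net : SoftFRNetwork K) (j : Fin K) : CellGroup → ℝ
  | .center => (net.Delta j - 1) / net.Delta j * net.lam j
  | .edge => 1 / net.Delta j * net.lam j

/-- Power ratio of the given group in tier `j`: `1` for center cells and `φ_j` for edge cells. -/
def ratio (net : SoftFRNetwork K) (j : Fin K) : CellGroup → ℝ
  | .center => 1
  | .edge => net.phi j

end SoftFRNetwork

/-- The mutually independent sources of randomness: the gain of the serving link, the positions
of the base stations of a group, the gain of each interfering link, and the indicator of each
interfering cell. -/
inductive RandomSource (K : ℕ) : Type where
  | serving : RandomSource K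
  | positions : Fin K → CellGroup → RandomSource K
  | gain : Fin K → CellGroup → ℕ → RandomSource K
  | indicator : Fin K → CellGroup → ℕ → RandomSource K

/-- A realization of the network, seen from the typical user at the origin of the plane, on a
probability space: the base stations other than the serving one, with their channel gains and
occupation indicators of the given resource block, and the channel gain of the serving link. -/
structure Downlink {K : ℕ} (net : SoftFRNetwork K) {Ω : Type*} [MeasurableSpace Ω]
    (μ : Measure Ω) where
  /-- positions of the base stations -/
  pos : Fin K → CellGroup → ℕ → Ω → EuclideanSpace ℝ (Fin 2)
  /-- channel power gains of the interfering links -/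
  gain : Fin K → CellGroup → ℕ → Ω → ℝ
  /-- indicators that the resource block is occupied -/
  tau : Fin K → CellGroup → ℕ → Ω → ℝ
  /-- channel power gain of the serving link -/
  servingGain : Ω → ℝ
  pos_poisson : ∀ j s, IsPoissonProcess μ (pos j s) (ENNReal.ofReal (net.density j s) • volume)
  gain_measurable : ∀ j s n, Measurable (gain j s n)
  gain_law : ∀ j s n, μ.map (gain j s n) = rayleighLognormal net.muz net.sigmaz
  tau_measurable : ∀ j s n, Measurable (tau j s n)
  tau_mem : ∀ j s n ω, tau j s n ω = 0 ∨ tau j s n ω = 1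
  tau_mean : ∀ j s n, ∫ ω, tau j s n ω ∂μ = net.eps j
  servingGain_measurable : Measurable servingGain
  servingGain_law : μ.map servingGain = rayleighLognormal net.muz net.sigmaz
  indep : iIndep (fun a : RandomSource K => match a with
    | .serving => MeasurableSpace.comap servingGain inferInstance
    | .positions j s => MeasurableSpace.comap (fun ω n => pos j s n ω) inferInstance
    | .gain j s n => MeasurableSpace.comap (gain j s n) inferInstance
    | .indicator j s n => MeasurableSpace.comap (tau j s n) inferInstance) μ

namespace Downlink

variable {K : ℕ} {net : SoftFRNetwork K} {Ω : Type*} [MeasurableSpace Ω] {μ : Measure Ω}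

/-- The interference power from the cells of one group of tier `j`. -/
noncomputable def groupInterference (D : Downlink net μ) (j : Fin K) (s : CellGroup) (ω : Ω) :
    ℝ≥0∞ :=
  ∑' n, ENNReal.ofReal (D.tau j s n ω * (net.ratio j s * net.P j) * D.gain j s n ω *
    ‖D.pos j s n ω‖ ^ (-net.alpha j))

/-- The total intercell interference. -/
noncomputable def interference (D : Downlink net μ) (ω : Ω) : ℝ≥0∞ :=
  ∑ j, D.groupInterference j .center ω + ∑ j, D.groupInterference j .edge ω

/-- The SINR of a cell-edge user whose serving base station belongs to tier `i` and lies at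
distance `r`. -/
noncomputable def sinr (D : Downlink net μ) (i : Fin K) (r : ℝ) (ω : Ω) : ℝ≥0∞ :=
  ENNReal.ofReal (net.phi i * net.P i * D.servingGain ω * r ^ (-net.alpha i)) /
    (D.interference ω + ENNReal.ofReal net.noise)

/-- The event that no other base station is closer to the user than `r`, i.e. that a base station
at distance `r` is the nearest one. -/
def nearestAt (D : Downlink net μ) (r : ℝ) : Set Ω :=
  {ω | ∀ j s n, r ≤ ‖D.pos j s n ω‖}

/-- Coverage probability, for the threshold `T`, of the cell-edge user at distance `r` from its
serving base station in tier `i`, this base station being the nearest one. -/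
noncomputable def coverage (D : Downlink net μ) (i : Fin K) (T r : ℝ) : ℝ :=
  (ProbabilityTheory.cond μ (D.nearestAt r)).real {ω | ENNReal.ofReal T ≤ D.sinr i r ω}

end Downlink

/-- `x`, `w` are the nodes and weights of the `N`-point Gauss quadrature rule of the measure `ν`:
the `N`-point rule that is exact on all polynomials of degree at most `2 N - 1`. -/
structure IsGaussRule (ν : Measure ℝ) {N : ℕ} (x w : Fin N → ℝ) : Prop where
  injective : Function.Injective x
  exact : ∀ p : Polynomial ℝ, p.natDegree < 2 * N →
    ∑ k, w k * p.eval (x k) = ∫ t, p.eval t ∂ν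

/-- The Gauss–Hermite weight `exp (-t²)` on the real line. -/
noncomputable def hermiteMeasure : Measure ℝ :=
  volume.withDensity (fun t => ENNReal.ofReal (Real.exp (-t ^ 2)))

/-- The Gauss–Legendre weight `1` on `[-1, 1]`. -/
noncomputable def legendreMeasure : Measure ℝ :=
  volume.restrict (Set.Icc (-1) 1)

namespace SoftFRNetwork

variable {K : ℕ}

/-- The signal-to-noise ratio `P_i / σ²`. -/
noncomputable def snr (net : SoftFRNetwork K) (i : Fin K) : ℝ := net.P i / net.noise

/-- The quantity `C = T γ(t₁) / γ(t) * (q P_j) / (φ_i P_i) * r ^ (α_i - α_j)`; here `q` is the power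
ratio of the interfering cells, `t` is the shadowing variable of the serving link and `t₁` that of
the interfering link. -/
noncomputable def cFactor (net : SoftFRNetwork K) (i j : Fin K) (T r q t t₁ : ℝ) : ℝ :=
  T * (shadowGain net.muz net.sigmaz t₁ / shadowGain net.muz net.sigmaz t) *
    ((q * net.P j) / (net.phi i * net.P i)) * r ^ (net.alpha i - net.alpha j)

/-- The first term of the bracket in `f_I`. -/
noncomputable def mainTerm (net : SoftFRNetwork K) (j : Fin K) (C : ℝ) : ℝ :=
  2 * Real.pi * C ^ (2 / net.alpha j) /
    (net.alpha j * Real.sin (Real.pi * (net.alpha j - 2) / net.alpha j))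

/-- The exact interference function `f_I`. -/
noncomputable def fI (net : SoftFRNetwork K) (i j : Fin K) (T r q t : ℝ) : ℝ :=
  ∫ t₁ : ℝ, Real.exp (-t₁ ^ 2) / √Real.pi *
    (net.mainTerm j (net.cFactor i j T r q t t₁) -
      ∫ u in (0 : ℝ)..1, net.cFactor i j T r q t t₁ /
        (net.cFactor i j T r q t t₁ + u ^ (net.alpha j / 2)))

/-- The quadrature expression of `f_I`, with Gauss–Hermite nodes and weights `a`, `w` and
Gauss–Legendre nodes and weights `x`, `c`. -/
noncomputable def fIQuad (net : SoftFRNetwork K) {NH NL : ℕ} (a w : Fin NH → ℝ)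
    (x c : Fin NL → ℝ) (i j : Fin K) (T r q t : ℝ) : ℝ :=
  ∑ n₁, w n₁ / √Real.pi *
    (net.mainTerm j (net.cFactor i j T r q t (a n₁)) -
      ∑ m, c m / 2 * (net.cFactor i j T r q t (a n₁) /
        (net.cFactor i j T r q t (a n₁) + ((x m + 1) / 2) ^ (net.alpha j / 2))))

/-- The product of the noise factor and the interference factor, for the shadowing variable `t` of
the serving link and an interference function `f` of `(j, q)`. -/
noncomputable def coverageTerm (net : SoftFRNetwork K) (i : Fin K) (T r t : ℝ)
    (f : Fin K → ℝ → ℝ) : ℝ :=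
  Real.exp (-(T * r ^ net.alpha i / shadowGain net.muz net.sigmaz t *
      (1 / (net.phi i * net.snr i)))) *
    Real.exp (-(Real.pi * r ^ 2 * ∑ j, net.eps j *
      (net.density j .center * f j 1 + net.density j .edge * f j (net.phi j))))

/-- The exact coverage expression. -/
noncomputable def coverageExact (net : SoftFRNetwork K) (i : Fin K) (T r : ℝ) : ℝ :=
  ∫ t : ℝ, Real.exp (-t ^ 2) / √Real.pi *
    net.coverageTerm i T r t (fun j q => net.fI i j T r q t)

/-- The Gauss–Hermite / Gauss–Legendre coverage expression. -/
noncomputable def coverageQuad (net : SoftFRNetwork K) {NH NL : ℕ} (a w : Fin NH → ℝ)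
    (x c : Fin NL → ℝ) (i : Fin K) (T r : ℝ) : ℝ :=
  ∑ n, w n / √Real.pi *
    net.coverageTerm i T r (a n) (fun j q => net.fIQuad a w x c i j T r q (a n))

end SoftFRNetwork

/-! Exact formula. Given the positions, the interfering marks and the shadowing value `t` of the
serving link, the exponential tail turns the event SINR ≥ T into a factor `exp (-c (I + σ²))`, with
`c = T r^α_i / (φ_i P_i γ(t))`. The event that no other base station is closer than `r` is also an
exponential: give every point of the open ball of radius `r` infinite cost. So one computation, the
Laplace functional of marked Poisson processes, yields both the probability of the conditioning
event and its joint expectation with the exponential. Averaging the marks first leaves a functional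
of the positions alone, and a Poisson process with intensity `Λ` satisfies `E exp (-∑ F) = exp (-∫
(1 - exp (-F)) dΛ)`.

For each group the exponent is `λ π r² (1 + ε f)`. The summand 1 comes from the ball and cancels
against the conditioning. The term `f` comes from the outside: polar coordinates reduce it to `∫_1^∞
C / (C + v^(α/2)) dv`, which is the integral over `(0, ∞)`, known from Euler's reflection formula,
minus the integral over `(0, 1)`. The key lemmas are `IsPoissonProcess.lintegral_expNeg_tsum`,
`Downlink.lintegral_expNeg_sum_tsum` and `SoftFRNetwork.lintegral_one_sub_markMean`.

Quadrature. Gauss weights are nonnegative, and by the Hermite interpolation error Gauss rules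
underestimate even moments, hence also integrals of `cosh`. This bound is uniform in the number of
nodes, so for a measure with all exponential moments the exponential series may be integrated
termwise in the limit, and the rules converge on every `exp (z t)`, `z` complex. Imaginary `z` gives
convergence of characteristic functions, hence weak convergence.

The inner quadrature changes with the order of the rules, so weak convergence is extended to bounded
families that converge continuously, that is, jointly in the index and the argument. The unbounded
part of the inner integrand is a multiple of a single real exponential and is covered directly; the
rest lies in `[0, 1]`. The inner value is therefore at least -1, which keeps the outer integrand
bounded. -/

/-! ### Gauss rules: positivity, even moments, weak convergence -/

open Polynomial in
/-- Iterated Rolle: differentiating `n` times loses at most `n` real roots. -/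
theorem card_roots_le_iterate_derivative (p : ℝ[X]) (n : ℕ) :
    Multiset.card p.roots ≤ Multiset.card (derivative^[n] p).roots + n := by
  induction n with
  | zero => simp
  | succ n ih =>
    rw [Function.iterate_succ_apply']
    have := card_roots_le_derivative (derivative^[n] p)
    omega

open Polynomial in
/-- Error of the Hermite interpolation of an even power at double nodes: the quotient by a squared
split polynomial is nonnegative. -/
theorem eval_pow_divByMonic_sq_nonneg {N : ℕ} (x : Fin N → ℝ) (k : ℕ) (s : ℝ) :
    0 ≤ ((X ^ (2 * k) : ℝ[X]) /ₘ (∏ i, (X - C (x i))) ^ 2).eval s := by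
  rcases Nat.eq_zero_or_pos N with rfl | hN
  · simpa using (even_two_mul k).pow_nonneg s
  set D : ℝ[X] := (∏ i, (X - C (x i))) ^ 2 with hD
  have hDm : D.Monic := (monic_prod_of_monic _ _ fun i _ => monic_X_sub_C _).pow 2
  have hDdeg : D.natDegree = 2 * N := by
    rw [hD, natDegree_pow, natDegree_prod_of_monic _ _ fun i _ => monic_X_sub_C _]
    simp
  have hDroots : Multiset.card D.roots = 2 * N := by
    rw [hD, roots_pow, Multiset.card_nsmul, roots_prod _ _
      (Finset.prod_ne_zero_iff.2 fun i _ => X_sub_C_ne_zero _)]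
    simp [roots_X_sub_C]
  set q := (X ^ (2 * k) : ℝ[X]) /ₘ D
  set p := (X ^ (2 * k) : ℝ[X]) %ₘ D
  set c := q.eval s
  have hsum : p + D * q = X ^ (2 * k) := modByMonic_add_div _ D
  have hp : derivative^[2 * N] p = 0 := by
    apply iterate_derivative_eq_zero
    rw [← hDdeg]
    refine natDegree_modByMonic_lt _ hDm fun h => ?_
    rw [h] at hDdeg
    simp at hDdeg
    omega
  have hDd : derivative^[2 * N] D = C ((2 * N).factorial : ℝ) := by
    have h1 : derivative^[2 * N] (D - X ^ (2 * N)) = 0 := by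
      by_cases h0 : D - X ^ (2 * N) = 0
      · simp [h0]
      apply iterate_derivative_eq_zero
      have := degree_sub_lt_left (p := D) (q := X ^ (2 * N))
        (by rw [degree_eq_natDegree hDm.ne_zero, hDdeg, degree_X_pow]) hDm.ne_zero
        (by rw [hDm.leadingCoeff, leadingCoeff_X_pow])
      have := natDegree_lt_natDegree h0 this
      omega
    rw [iterate_derivative_sub, sub_eq_zero] at h1
    rw [h1, iterate_derivative_X_pow_eq_C_mul]
    simp [Nat.descFactorial_self]
  -- `G` vanishes at `s` and at the `2N` roots of `D`, counted with multiplicity, so Rolle gives its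
  -- `2N`-th derivative a zero `ξ`. There `c (2N)!` equals the `2N`-th derivative of `X ^ (2k)`,
  -- which is nonnegative.
  set G : ℝ[X] := (q - C c) * D with hG
  have hGd : derivative^[2 * N] G =
      derivative^[2 * N] (X ^ (2 * k)) - C (c * (2 * N).factorial) := by
    have : G = X ^ (2 * k) - p - C c * D := by rw [← hsum, hG]; ring
    rw [this, iterate_derivative_sub, iterate_derivative_sub, hp, iterate_derivative_C_mul, hDd,
      sub_zero, C_mul]
  obtain ⟨ξ, hξ⟩ : ∃ ξ, (derivative^[2 * N] G).eval ξ = 0 := by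
    by_cases hG0 : G = 0
    · exact ⟨0, by simp [hG0]⟩
    have h1 := card_roots_le_iterate_derivative G (2 * N)
    have hqc : q - C c ≠ 0 := left_ne_zero_of_mul hG0
    have h2 : 0 < Multiset.card (q - C c).roots :=
      Multiset.card_pos_iff_exists_mem.2 ⟨s, by
        rw [mem_roots hqc]; simp [IsRoot, c]⟩
    rw [hG, roots_mul hG0, Multiset.card_add, hDroots, ← hG] at h1
    obtain ⟨ξ, hξ⟩ := Multiset.card_pos_iff_exists_mem.1
      (show 0 < Multiset.card (derivative^[2 * N] G).roots by omega)
    exact ⟨ξ, isRoot_of_mem_roots hξ⟩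
  rw [hGd, iterate_derivative_X_pow_eq_C_mul] at hξ
  simp only [eval_sub, eval_mul, eval_C, eval_pow, eval_X] at hξ
  -- The subtraction is truncated; for `k < N` the exponent is 0, which is still even.
  have h3 : 0 ≤ ξ ^ (2 * k - 2 * N) := Even.pow_nonneg (by rw [← Nat.mul_sub]; simp) _
  have h4 : 0 ≤ c * ((2 * N).factorial : ℝ) := by
    rw [← sub_eq_zero.1 hξ]; positivity
  exact nonneg_of_mul_nonneg_left h4 (by positivity)

namespace IsGaussRule

open Polynomial

variable {ν : Measure ℝ} {N : ℕ} {x w : Fin N → ℝ}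

/-- The square of the product over the other nodes has degree `2N - 2`, so the rule is exact on it,
and only the node `x k` contributes. -/
theorem weight_nonneg (h : IsGaussRule ν x w) (k : Fin N) : 0 ≤ w k := by
  have hN : 0 < N := k.pos
  set p : ℝ[X] := (∏ l ∈ Finset.univ.erase k, (X - C (x l))) ^ 2 with hp
  have hdeg : p.natDegree < 2 * N := by
    rw [hp, natDegree_pow, natDegree_prod_of_monic _ _ fun i _ => monic_X_sub_C _]
    simp; omega
  have h1 := h.exact p hdeg
  have h2 : ∀ l, l ≠ k → p.eval (x l) = 0 := fun l hl => by
    rw [hp, eval_pow, eval_prod, Finset.prod_eq_zero (Finset.mem_erase.2 ⟨hl, Finset.mem_univ l⟩)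
      (by simp)]
    simp
  rw [Finset.sum_eq_single k (fun l _ hl => by rw [h2 l hl, mul_zero]) (by simp)] at h1
  have h3 : 0 < p.eval (x k) := by
    rw [hp, eval_pow, eval_prod]
    refine sq_pos_iff.2 (Finset.prod_ne_zero_iff.2 fun l hl => ?_)
    simpa [sub_eq_zero] using fun e => Finset.ne_of_mem_erase hl (h.injective e.symm)
  have h4 : 0 ≤ w k * p.eval (x k) := by
    rw [h1]
    exact integral_nonneg fun t => by rw [hp, eval_pow]; positivity
  exact nonneg_of_mul_nonneg_left h4 h3

theorem sum_weight (h : IsGaussRule ν x w) (hN : 0 < N) : ∑ k, w k = ν.real Set.univ := by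
  simpa using h.exact 1 (by simpa using hN)

theorem sum_weight_le (h : IsGaussRule ν x w) : ∑ k, w k ≤ ν.real Set.univ := by
  rcases Nat.eq_zero_or_pos N with rfl | hN
  · simp
  · exact (h.sum_weight hN).le

/-- A rule for a measure supported on `[-1, 1]` puts no weight outside this interval. -/
theorem node_mem_Icc (h : IsGaussRule ν x w) (hν : ∀ᵐ t ∂ν, t ∈ Set.Icc (-1 : ℝ) 1) {k : Fin N}
    (hk : w k ≠ 0) : x k ∈ Set.Icc (-1 : ℝ) 1 := by
  have hN : 0 < N := k.pos
  have hw : 0 < w k := lt_of_le_of_ne (h.weight_nonneg k) hk.symm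
  set p : ℝ[X] := (∏ l ∈ Finset.univ.erase k, (X - C (x l))) ^ 2 with hp
  have hdeg : p.natDegree + 1 < 2 * N := by
    rw [hp, natDegree_pow, natDegree_prod_of_monic _ _ fun i _ => monic_X_sub_C _]
    simp; omega
  have h2 : ∀ l, l ≠ k → p.eval (x l) = 0 := fun l hl => by
    rw [hp, eval_pow, eval_prod, Finset.prod_eq_zero (Finset.mem_erase.2 ⟨hl, Finset.mem_univ l⟩)
      (by simp)]
    simp
  have h3 : 0 < p.eval (x k) := by
    rw [hp, eval_pow, eval_prod]
    refine sq_pos_iff.2 (Finset.prod_ne_zero_iff.2 fun l hl => ?_)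
    simpa [sub_eq_zero] using fun e => Finset.ne_of_mem_erase hl (h.injective e.symm)
  -- The test polynomial `(1 + a X) p` has degree at most `2N - 1`, the limit of exactness, and is
  -- nonnegative on the support. For `a = 1` and `a = -1` it gives the two bounds on the node.
  have key : ∀ a : ℝ, |a| = 1 → 0 ≤ 1 + a * x k := fun a ha => by
    have h1 := h.exact ((1 + C a * X) * p) (lt_of_le_of_lt natDegree_mul_le (by
      have : (1 + C a * X : ℝ[X]).natDegree ≤ 1 := by compute_degree
      omega))
    rw [Finset.sum_eq_single k
      (fun l _ hl => by rw [eval_mul, h2 l hl, mul_zero, mul_zero]) (by simp)] at h1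
    have h4 : 0 ≤ w k * ((1 + C a * X) * p).eval (x k) := by
      rw [h1]
      refine integral_nonneg_of_ae (hν.mono fun t ht => ?_)
      have h5 : 0 ≤ 1 + a * t := by
        have h6 : |a * t| ≤ 1 := by rw [abs_mul, ha, one_mul]; exact abs_le.2 ht
        linarith [(abs_le.1 h6).1]
      have h7 : 0 ≤ p.eval t := by rw [hp, eval_pow]; positivity
      simpa using mul_nonneg h5 h7
    have h5 := nonneg_of_mul_nonneg_right h4 hw
    simp only [eval_mul, eval_add, eval_one, eval_C, eval_X] at h5
    exact nonneg_of_mul_nonneg_left h5 h3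
  constructor
  · linarith [key 1 (by simp)]
  · linarith [key (-1) (by simp)]

theorem const_mul (h : IsGaussRule ν x w) {c : ℝ} (hc : 0 ≤ c) :
    IsGaussRule (ENNReal.ofReal c • ν) x (fun k => c * w k) where
  injective := h.injective
  exact p hp := by
    rw [integral_smul_measure, ENNReal.toReal_ofReal hc, ← h.exact p hp, smul_eq_mul,
      Finset.mul_sum]
    exact Finset.sum_congr rfl fun _ _ => mul_assoc _ _ _

end IsGaussRule

theorem integrable_pow_of_forall_integrable_exp {ν : Measure ℝ}
    (hν : ∀ c : ℝ, Integrable (fun t => Real.exp (c * t)) ν) (n : ℕ) :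
    Integrable (fun t => t ^ n) ν :=
  integrable_pow_of_integrable_exp_mul (X := fun t => t) one_ne_zero (hν 1) (hν (-1)) n

open Polynomial in
theorem integrable_eval_of_forall_integrable_exp {ν : Measure ℝ}
    (hν : ∀ c : ℝ, Integrable (fun t => Real.exp (c * t)) ν) (p : ℝ[X]) :
    Integrable (fun t => p.eval t) ν := by
  simp_rw [eval_eq_sum_range]
  exact integrable_finsetSum _ fun i _ =>
    (integrable_pow_of_forall_integrable_exp hν i).const_mul _

theorem integrable_cosh_of_forall_integrable_exp {ν : Measure ℝ}
    (hν : ∀ c : ℝ, Integrable (fun t => Real.exp (c * t)) ν) (c : ℝ) :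
    Integrable (fun t => Real.cosh (c * t)) ν := by
  simp_rw [Real.cosh_eq]
  exact ((hν c).add (by simpa using hν (-c))).div_const 2

namespace IsGaussRule

variable {ν : Measure ℝ}

open Polynomial in
/-- Gauss rules underestimate the even moments. -/
theorem sum_pow_le (hν : ∀ c : ℝ, Integrable (fun t => Real.exp (c * t)) ν) {N : ℕ}
    {x w : Fin N → ℝ} (h : IsGaussRule ν x w) (k : ℕ) :
    ∑ n, w n * x n ^ (2 * k) ≤ ∫ t, t ^ (2 * k) ∂ν := by
  rcases Nat.eq_zero_or_pos N with rfl | hN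
  · simpa using integral_nonneg fun t => (even_two_mul k).pow_nonneg t
  set D : ℝ[X] := (∏ i, (X - C (x i))) ^ 2 with hD
  have hDm : D.Monic := (monic_prod_of_monic _ _ fun i _ => monic_X_sub_C _).pow 2
  have hDdeg : D.natDegree = 2 * N := by
    rw [hD, natDegree_pow, natDegree_prod_of_monic _ _ fun i _ => monic_X_sub_C _]
    simp
  set q := (X ^ (2 * k) : ℝ[X]) /ₘ D
  set p := (X ^ (2 * k) : ℝ[X]) %ₘ D
  have hsum : p + D * q = X ^ (2 * k) := modByMonic_add_div _ D
  have hp : p.natDegree < 2 * N := by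
    rw [← hDdeg]
    refine natDegree_modByMonic_lt _ hDm fun h => ?_
    rw [h] at hDdeg
    simp at hDdeg
    omega
  -- The nodes are zeros of `D`, so the rule only sees the remainder `p`, which it integrates
  -- exactly. What is lost, `D * q`, is nonnegative everywhere.
  have hnode : ∀ n, x n ^ (2 * k) = p.eval (x n) := fun n => by
    have : D.eval (x n) = 0 := by
      rw [hD, eval_pow, eval_prod, Finset.prod_eq_zero (Finset.mem_univ n) (by simp)]; simp
    have h1 := congrArg (eval (x n)) hsum
    simpa [this] using h1.symm
  simp_rw [hnode]
  rw [h.exact p hp]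
  refine integral_mono (integrable_eval_of_forall_integrable_exp hν p)
    (integrable_pow_of_forall_integrable_exp hν _) fun t => ?_
  have h1 := congrArg (eval t) hsum
  simp only [eval_add, eval_mul, eval_pow, eval_X] at h1
  have h2 : 0 ≤ D.eval t := by rw [hD, eval_pow]; positivity
  have h3 := mul_nonneg h2 (eval_pow_divByMonic_sq_nonneg x k t)
  dsimp only
  linarith

/-- The power series of `cosh` has only even powers, with nonnegative coefficients, so `sum_pow_le`
applies term by term. The bound does not depend on `N` and serves as the dominating constant below.
-/
theorem sum_cosh_le (hν : ∀ c : ℝ, Integrable (fun t => Real.exp (c * t)) ν) {N : ℕ}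
    {x w : Fin N → ℝ} (h : IsGaussRule ν x w) (c : ℝ) :
    ∑ n, w n * Real.cosh (c * x n) ≤ ∫ t, Real.cosh (c * t) ∂ν := by
  have h1 : HasSum (fun k : ℕ => ∑ n, w n * ((c * x n) ^ (2 * k) / ((2 * k).factorial : ℝ)))
      (∑ n, w n * Real.cosh (c * x n)) :=
    hasSum_sum fun n _ => (Real.hasSum_cosh _).mul_left _
  refine hasSum_le_of_sum_le h1 fun s => ?_
  calc ∑ k ∈ s, ∑ n, w n * ((c * x n) ^ (2 * k) / ((2 * k).factorial : ℝ))
      = ∑ k ∈ s, c ^ (2 * k) / ((2 * k).factorial : ℝ) * ∑ n, w n * x n ^ (2 * k) := by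
        refine Finset.sum_congr rfl fun k _ => ?_
        rw [Finset.mul_sum]
        exact Finset.sum_congr rfl fun n _ => by rw [mul_pow]; ring
    _ ≤ ∑ k ∈ s, c ^ (2 * k) / ((2 * k).factorial : ℝ) * ∫ t, t ^ (2 * k) ∂ν := by
        refine Finset.sum_le_sum fun k _ => mul_le_mul_of_nonneg_left (h.sum_pow_le hν k) ?_
        have := (even_two_mul k).pow_nonneg c
        positivity
    _ = ∫ t, ∑ k ∈ s, (c * t) ^ (2 * k) / ((2 * k).factorial : ℝ) ∂ν := by
        rw [integral_finsetSum]
        · refine Finset.sum_congr rfl fun k _ => ?_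
          rw [← integral_const_mul]
          exact integral_congr_ae (ae_of_all _ fun t => by simp only [mul_pow]; ring)
        · intro k _
          simp_rw [mul_pow]
          exact ((integrable_pow_of_forall_integrable_exp hν _).const_mul _).div_const _
    _ ≤ ∫ t, Real.cosh (c * t) ∂ν := by
        refine integral_mono ?_ (integrable_cosh_of_forall_integrable_exp hν c) fun t => ?_
        · refine integrable_finsetSum _ fun k _ => ?_
          simp_rw [mul_pow]
          exact ((integrable_pow_of_forall_integrable_exp hν _).const_mul _).div_const _
        · refine sum_le_hasSum s (fun k _ => ?_) (Real.hasSum_cosh (c * t))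
          have := (even_two_mul k).pow_nonneg (c * t)
          positivity

/-- The sequence is eventually constant: the rule is exact on `t ^ k` as soon as `N > k`. -/
theorem tendsto_sum_pow {x w : (N : ℕ) → Fin N → ℝ} (h : ∀ N, IsGaussRule ν (x N) (w N))
    (k : ℕ) :
    Tendsto (fun N => ∑ n, w N n * x N n ^ k) atTop (𝓝 (∫ t, t ^ k ∂ν)) := by
  refine tendsto_const_nhds.congr' ((eventually_gt_atTop k).mono fun N hN => ?_)
  simpa using ((h N).exact (Polynomial.X ^ k) (by simp; omega)).symm

/-- Taylor terms of the exponential are geometrically small relative to a hyperbolic cosine. -/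
theorem _root_.abs_pow_div_factorial_le_cosh (r t : ℝ) (hr : 0 ≤ r) (k : ℕ) :
    r ^ k / (k.factorial : ℝ) * |t| ^ k ≤ (1 / 2) ^ k * (2 * Real.cosh (2 * r * t)) := by
  have h1 : (2 * r * |t|) ^ k / (k.factorial : ℝ) ≤ Real.exp (2 * r * |t|) :=
    Real.pow_div_factorial_le_exp _ (by positivity) k
  have h2 : Real.exp (2 * r * |t|) ≤ 2 * Real.cosh (2 * r * t) := by
    rw [← Real.cosh_abs, abs_mul, abs_of_nonneg (by positivity : 0 ≤ 2 * r), Real.cosh_eq]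
    linarith [Real.exp_pos (-(2 * r * |t|))]
  calc r ^ k / (k.factorial : ℝ) * |t| ^ k
      = (1 / 2) ^ k * ((2 * r * |t|) ^ k / (k.factorial : ℝ)) := by
        have : (1 / 2 : ℝ) ^ k * 2 ^ k = 1 := by rw [← mul_pow]; norm_num
        rw [mul_pow, mul_pow]
        linear_combination (-(r ^ k * |t| ^ k) / (k.factorial : ℝ)) * this
    _ ≤ _ := by gcongr; exact h1.trans h2

/-- Gauss quadrature converges for complex exponentials. -/
theorem tendsto_sum_cexp (hν : ∀ c : ℝ, Integrable (fun t => Real.exp (c * t)) ν)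
    {x w : (N : ℕ) → Fin N → ℝ} (h : ∀ N, IsGaussRule ν (x N) (w N)) (z : ℂ) :
    Tendsto (fun N => ∑ n, (w N n : ℂ) * Complex.exp (z * x N n)) atTop
      (𝓝 (∫ t, Complex.exp (z * t) ∂ν)) := by
  have hcosh := integrable_cosh_of_forall_integrable_exp hν (2 * ‖z‖)
  -- Doubling the rate inside `cosh` buys the factor `(1 / 2) ^ k`: the bound is summable in `k`,
  -- integrable in `t`, and controlled under every rule by `sum_cosh_le`.
  have hterm : ∀ (t : ℝ) (k : ℕ), ‖(z * t) ^ k / (k.factorial : ℂ)‖ ≤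
      (1 / 2) ^ k * (2 * Real.cosh (2 * ‖z‖ * t)) := fun t k => by
    refine le_trans (le_of_eq ?_) (abs_pow_div_factorial_le_cosh ‖z‖ t (norm_nonneg z) k)
    simp [mul_pow]
    ring
  have hgeom : ∀ c : ℝ, Summable fun k : ℕ => (1 / 2 : ℝ) ^ k * c := fun c =>
    (summable_geometric_of_lt_one (by norm_num) (by norm_num)).mul_right c
  have hexp : ∀ y : ℂ, HasSum (fun k : ℕ => y ^ k / (k.factorial : ℂ)) (Complex.exp y) :=
    fun y => by
      rw [Complex.exp_eq_exp_ℂ]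
      exact NormedSpace.expSeries_div_hasSum_exp y
  have hint : HasSum (fun k : ℕ => ∫ t : ℝ, (z * t) ^ k / (k.factorial : ℂ) ∂ν)
      (∫ t : ℝ, Complex.exp (z * t) ∂ν) := by
    refine hasSum_integral_of_dominated_convergence
      (fun (k : ℕ) (t : ℝ) => (1 / 2 : ℝ) ^ k * (2 * Real.cosh (2 * ‖z‖ * t)))
      (fun k => by fun_prop) (fun k => ae_of_all _ fun t => hterm t k)
      (ae_of_all _ fun t => hgeom _) ?_ (ae_of_all _ fun t => hexp _)
    simp_rw [tsum_mul_right]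
    exact (hcosh.const_mul 2).const_mul _
  have hsum : ∀ N, HasSum (fun k : ℕ => ∑ n, (w N n : ℂ) * ((z * x N n) ^ k / (k.factorial : ℂ)))
      (∑ n, (w N n : ℂ) * Complex.exp (z * x N n)) := fun N =>
    hasSum_sum fun n _ => (hexp _).mul_left _
  simp_rw [← (hsum _).tsum_eq, ← hint.tsum_eq]
  refine tendsto_tsum_of_dominated_convergence
    (bound := fun k => (1 / 2 : ℝ) ^ k * (2 * ∫ t, Real.cosh (2 * ‖z‖ * t) ∂ν)) (hgeom _)
    (fun k => ?_) (Eventually.of_forall fun N k => ?_)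
  · have h1 : ∀ N, ∑ n, (w N n : ℂ) * ((z * x N n) ^ k / (k.factorial : ℂ)) =
        z ^ k / (k.factorial : ℂ) * ((∑ n, w N n * x N n ^ k : ℝ) : ℂ) := fun N => by
      push_cast
      rw [Finset.mul_sum]
      exact Finset.sum_congr rfl fun n _ => by ring
    have h2 : ∫ t : ℝ, (z * t) ^ k / (k.factorial : ℂ) ∂ν =
        z ^ k / (k.factorial : ℂ) * ((∫ t, t ^ k ∂ν : ℝ) : ℂ) := by
      rw [← integral_complex_ofReal, ← integral_const_mul]
      exact integral_congr_ae (ae_of_all _ fun t => by simp only [Complex.ofReal_pow]; ring)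
    simp_rw [h1, h2]
    exact ((Complex.continuous_ofReal.tendsto _).comp (tendsto_sum_pow h k)).const_mul _
  · calc ‖∑ n, (w N n : ℂ) * ((z * x N n) ^ k / (k.factorial : ℂ))‖
        ≤ ∑ n, w N n * ((1 / 2) ^ k * (2 * Real.cosh (2 * ‖z‖ * x N n))) := by
          refine norm_sum_le_of_le _ fun n _ => ?_
          have hw := (h N).weight_nonneg n
          rw [norm_mul, Complex.norm_real, Real.norm_of_nonneg hw]
          exact mul_le_mul_of_nonneg_left (hterm _ k) hw
      _ = (1 / 2) ^ k * (2 * ∑ n, w N n * Real.cosh (2 * ‖z‖ * x N n)) := by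
          simp_rw [Finset.mul_sum]
          exact Finset.sum_congr rfl fun n _ => by ring
      _ ≤ _ := by gcongr; exact (h N).sum_cosh_le hν _

/-- Gauss quadrature converges for real exponentials. -/
theorem tendsto_sum_exp (hν : ∀ c : ℝ, Integrable (fun t => Real.exp (c * t)) ν)
    {x w : (N : ℕ) → Fin N → ℝ} (h : ∀ N, IsGaussRule ν (x N) (w N)) (c : ℝ) :
    Tendsto (fun N => ∑ n, w N n * Real.exp (c * x N n)) atTop
      (𝓝 (∫ t, Real.exp (c * t) ∂ν)) := by
  have h1 := (Complex.continuous_re.tendsto _).comp (tendsto_sum_cexp hν h c)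
  have h2 : ∫ t : ℝ, Complex.exp (c * t) ∂ν = ((∫ t, Real.exp (c * t) ∂ν : ℝ) : ℂ) := by
    rw [← integral_complex_ofReal]
    exact integral_congr_ae (ae_of_all _ fun t => by simp)
  rw [h2, Complex.ofReal_re] at h1
  refine h1.congr fun N => ?_
  simp only [Function.comp, ← Complex.ofReal_mul, ← Complex.ofReal_exp, ← Complex.ofReal_sum,
    Complex.ofReal_re]

/-- Gauss quadrature converges for bounded continuous functions. -/
theorem tendsto_sum_boundedContinuous [IsProbabilityMeasure ν]
    (hν : ∀ c : ℝ, Integrable (fun t => Real.exp (c * t)) ν)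
    {x w : (N : ℕ) → Fin N → ℝ} (h : ∀ N, IsGaussRule ν (x N) (w N))
    (f : BoundedContinuousFunction ℝ ℝ) :
    Tendsto (fun N => ∑ n, w N n * f (x N n)) atTop (𝓝 (∫ t, f t ∂ν)) := by
  -- The index is shifted by one because the rule without nodes has total mass 0.
  let Q : ℕ → Measure ℝ := fun N =>
    ∑ n, ENNReal.ofReal (w (N + 1) n) • Measure.dirac (x (N + 1) n)
  have hQ : ∀ N, IsProbabilityMeasure (Q N) := fun N => ⟨by
    simp only [Q, Measure.coe_finsetSum, Finset.sum_apply, Measure.smul_apply, measure_univ,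
      smul_eq_mul, mul_one]
    rw [← ENNReal.ofReal_sum_of_nonneg fun n _ => (h (N + 1)).weight_nonneg n,
      (h (N + 1)).sum_weight N.succ_pos]
    simp⟩
  have hint : ∀ {E : Type} [NormedAddCommGroup E] [NormedSpace ℝ E] [CompleteSpace E] (N : ℕ)
      (g : ℝ → E), ∫ t, g t ∂(Q N) = ∑ n, w (N + 1) n • g (x (N + 1) n) := fun N g => by
    simp only [Q]
    rw [integral_finsetSum_measure fun n _ =>
      (integrable_dirac (by simp)).smul_measure ENNReal.ofReal_ne_top]
    refine Finset.sum_congr rfl fun n _ => ?_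
    rw [integral_smul_measure, integral_dirac, ENNReal.toReal_ofReal ((h (N + 1)).weight_nonneg n)]
  let QP : ℕ → ProbabilityMeasure ℝ := fun N => ⟨Q N, hQ N⟩
  let νP : ProbabilityMeasure ℝ := ⟨ν, inferInstance⟩
  -- Lévy's continuity theorem: the characteristic function of `Q N` at `ξ` is the quadrature of
  -- `exp (i ξ t)`.
  have hweak : Tendsto QP atTop (𝓝 νP) := by
    rw [ProbabilityMeasure.tendsto_iff_tendsto_charFun]
    intro ξ
    have h1 := (tendsto_add_atTop_iff_nat 1).2 (tendsto_sum_cexp hν h (ξ * Complex.I))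
    simp only [QP, νP, charFun_apply_real, ProbabilityMeasure.coe_mk]
    simp_rw [hint]
    have e : ∀ t : ℝ, (ξ : ℂ) * t * Complex.I = ξ * Complex.I * t := fun t => by ring
    simp_rw [e, Complex.real_smul]
    exact h1
  have h1 := ProbabilityMeasure.tendsto_iff_forall_integral_tendsto.1 hweak f
  simp only [QP, νP, ProbabilityMeasure.coe_mk] at h1
  simp_rw [hint, smul_eq_mul] at h1
  exact (tendsto_add_atTop_iff_nat 1).1 h1

end IsGaussRule

/-! ### Quadrature of integrands that vary with the order -/

/-- The limit of a continuously converging family of functions is continuous. -/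
theorem continuous_of_continuous_convergence {ι X : Type*} [TopologicalSpace X] {l : Filter ι}
    [l.NeBot] {F : ι → X → ℝ} {f : X → ℝ}
    (hF : ∀ x, Tendsto (fun p : ι × X => F p.1 p.2) (l ×ˢ 𝓝 x) (𝓝 (f x))) : Continuous f := by
  have hpt : ∀ x, Tendsto (fun i => F i x) l (𝓝 (f x)) := fun x =>
    (hF x).comp (tendsto_id.prodMk (tendsto_const_nhds.mono_right (le_refl (𝓝 x))))
  refine continuous_iff_continuousAt.2 fun x => ?_
  -- A closed neighbourhood `V` retains the limits `f y` of values `F i y` lying in it.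
  refine (closed_nhds_basis (f x)).tendsto_right_iff.2 fun V hV => ?_
  have h1 : ∀ᶠ p : X × ι in 𝓝 x ×ˢ l, F p.2 p.1 ∈ V := by
    have := (hF x).eventually hV.1
    exact (tendsto_prod_swap.eventually this)
  refine h1.curry.mono fun y hy => ?_
  exact hV.2.mem_of_tendsto (hpt y) hy

/-- Gauss quadrature of a bounded, continuously converging family of functions. -/
theorem IsGaussRule.tendsto_sum_of_continuous_convergence {ν : Measure ℝ} [IsProbabilityMeasure ν]
    (hν : ∀ c : ℝ, Integrable (fun t => Real.exp (c * t)) ν)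
    {x w : (N : ℕ) → Fin N → ℝ} (h : ∀ N, IsGaussRule ν (x N) (w N))
    {ι : Type*} {l : Filter ι} [l.NeBot] {n : ι → ℕ} (hn : Tendsto n l atTop)
    {F : ι → ℝ → ℝ} {f : ℝ → ℝ} {B : ℝ} (hB : ∀ᶠ i in l, ∀ t, |F i t| ≤ B)
    (hF : ∀ t, Tendsto (fun p : ι × ℝ => F p.1 p.2) (l ×ˢ 𝓝 t) (𝓝 (f t))) :
    Tendsto (fun i => ∑ k, w (n i) k * F i (x (n i) k)) l (𝓝 (∫ t, f t ∂ν)) := by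
  have hpt : ∀ t, Tendsto (fun i => F i t) l (𝓝 (f t)) := fun t =>
    (hF t).comp (tendsto_id.prodMk (tendsto_const_nhds.mono_right (le_refl (𝓝 t))))
  have hfc : Continuous f := continuous_of_continuous_convergence hF
  have hfB : ∀ t, |f t| ≤ B := fun t =>
    le_of_tendsto (hpt t).abs (hB.mono fun i hi => hi t)
  have hB0 : 0 ≤ B := (abs_nonneg _).trans (hfB 0)
  let fb : BoundedContinuousFunction ℝ ℝ :=
    BoundedContinuousFunction.ofNormedAddCommGroup f hfc B hfB
  have hmain : Tendsto (fun i => ∑ k, w (n i) k * f (x (n i) k)) l (𝓝 (∫ t, f t ∂ν)) :=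
    (IsGaussRule.tendsto_sum_boundedContinuous hν h fb).comp hn
  have hdiff : Tendsto (fun i => ∑ k, w (n i) k * (F i (x (n i) k) - f (x (n i) k))) l (𝓝 0) := by
    rw [Metric.tendsto_nhds]
    intro ε hε
    set m := ∫ t, t ^ (2 * 1) ∂ν
    have hm : 0 ≤ m := integral_nonneg fun t => (even_two_mul 1).pow_nonneg t
    -- Chebyshev: outside `[-R, R]` the difference is at most `2B`, and the second moment of every
    -- rule is at most `m`, so the tail contributes at most `2Bm / R²`.
    obtain ⟨R, hR0, hR⟩ : ∃ R : ℝ, 0 < R ∧ 2 * B * m / R ^ 2 < ε / 2 := by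
      have h1 : Tendsto (fun R : ℝ => 2 * B * m / R ^ 2) atTop (𝓝 0) :=
        tendsto_const_nhds.div_atTop (tendsto_pow_atTop two_ne_zero)
      obtain ⟨R, h2, h3⟩ := ((h1.eventually_lt_const (half_pos hε)).and
        (eventually_gt_atTop 0)).exists
      exact ⟨R, h3, h2⟩
    -- Continuous convergence at each point of a compact interval is uniform on it.
    have hunif : ∀ᶠ i in l, ∀ t ∈ Set.Icc (-R) R, |F i t - f t| < ε / 2 := by
      suffices h0 : ∀ᶠ p : ι × ℝ in l ×ˢ 𝓝ˢ (Set.Icc (-R) R), |F p.1 p.2 - f p.2| < ε / 2 from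
        h0.curry.mono fun _ h ↦ h.self_of_nhdsSet
      rw [isCompact_Icc.prod_nhdsSet_eq_biSup]
      simp only [eventually_iSup]
      intro t _
      have h1 : Tendsto (fun p : ι × ℝ => F p.1 p.2 - f p.2) (l ×ˢ 𝓝 t) (𝓝 0) := by
        have := (hF t).sub ((hfc.tendsto t).comp (tendsto_snd (f := l)))
        simpa using this
      have h2 := h1.abs.eventually_lt_const (show |(0 : ℝ)| < ε / 2 by simpa using half_pos hε)
      exact h2
    filter_upwards [hunif, hB] with i hi hBi
    have hw := (h (n i)).weight_nonneg
    rw [Real.dist_0_eq_abs]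
    calc |∑ k, w (n i) k * (F i (x (n i) k) - f (x (n i) k))|
        ≤ ∑ k, w (n i) k * (ε / 2 + 2 * B / R ^ 2 * x (n i) k ^ (2 * 1)) := by
          refine (Finset.abs_sum_le_sum_abs _ _).trans (Finset.sum_le_sum fun k _ => ?_)
          rw [abs_mul, abs_of_nonneg (hw k)]
          refine mul_le_mul_of_nonneg_left ?_ (hw k)
          by_cases hx : x (n i) k ∈ Set.Icc (-R) R
          · have := hi _ hx
            have : 0 ≤ 2 * B / R ^ 2 * x (n i) k ^ (2 * 1) :=
              mul_nonneg (by positivity) ((even_two_mul 1).pow_nonneg _)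
            linarith
          · have h1 : R ^ 2 ≤ x (n i) k ^ (2 * 1) := by
              rw [mul_one, sq_le_sq, abs_of_pos hR0]
              by_contra! hc
              exact hx (abs_le.1 hc.le)
            have h2 : |F i (x (n i) k) - f (x (n i) k)| ≤ 2 * B := by
              have := abs_sub (F i (x (n i) k)) (f (x (n i) k))
              linarith [hBi (x (n i) k), hfB (x (n i) k)]
            have h3 : 2 * B ≤ 2 * B / R ^ 2 * x (n i) k ^ (2 * 1) := by
              rw [div_mul_eq_mul_div, le_div_iff₀ (by positivity)]
              exact mul_le_mul_of_nonneg_left h1 (by positivity)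
            linarith
      _ = ε / 2 * ∑ k, w (n i) k + 2 * B / R ^ 2 * ∑ k, w (n i) k * x (n i) k ^ (2 * 1) := by
          simp_rw [Finset.mul_sum, ← Finset.sum_add_distrib]
          exact Finset.sum_congr rfl fun k _ => by ring
      _ ≤ ε / 2 * 1 + 2 * B / R ^ 2 * m := by
          gcongr
          · simpa using (h (n i)).sum_weight_le
          · exact (h (n i)).sum_pow_le hν 1
      _ < ε := by
          have : 2 * B / R ^ 2 * m = 2 * B * m / R ^ 2 := by ring
          linarith
  have := hdiff.add hmain
  rw [zero_add] at this
  refine this.congr fun i => ?_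
  rw [← Finset.sum_add_distrib]
  exact Finset.sum_congr rfl fun k _ => by ring

/-! ### Gauss–Hermite and Gauss–Legendre weights as probability measures -/

theorem gaussianPDFReal_zero_half (t : ℝ) :
    gaussianPDFReal 0 (1 / 2) t = Real.exp (-t ^ 2) / √Real.pi := by
  rw [gaussianPDFReal]
  have : 2 * Real.pi * ((1 / 2 : NNReal) : ℝ) = Real.pi := by push_cast; ring
  rw [this]
  have h2 : -(t - 0) ^ 2 / (2 * ((1 / 2 : NNReal) : ℝ)) = -t ^ 2 := by push_cast; ring
  rw [h2]; ring

theorem integral_exp_neg_sq_div_mul (f : ℝ → ℝ) :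
    ∫ t, Real.exp (-t ^ 2) / √Real.pi * f t = ∫ t, f t ∂(gaussianReal 0 (1 / 2)) := by
  rw [integral_gaussianReal_eq_integral_smul (by norm_num)]
  simp_rw [gaussianPDFReal_zero_half, smul_eq_mul]

theorem smul_hermiteMeasure :
    ENNReal.ofReal (1 / √Real.pi) • hermiteMeasure = gaussianReal 0 (1 / 2) := by
  rw [gaussianReal_of_var_ne_zero _ (by norm_num), hermiteMeasure,
    ← withDensity_smul _ (by fun_prop)]
  congr 1
  ext t
  rw [Pi.smul_apply, smul_eq_mul, ← ENNReal.ofReal_mul (by positivity), gaussianPDF,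
    gaussianPDFReal_zero_half]
  congr 1
  ring

theorem integrable_exp_gaussian (c : ℝ) :
    Integrable (fun t => Real.exp (c * t)) (gaussianReal 0 (1 / 2)) :=
  integrable_exp_mul_gaussianReal c

theorem IsGaussRule.hermite_div {N : ℕ} {a w : Fin N → ℝ} (h : IsGaussRule hermiteMeasure a w) :
    IsGaussRule (gaussianReal 0 (1 / 2)) a (fun n => w n / √Real.pi) := by
  have := h.const_mul (c := 1 / √Real.pi) (by positivity)
  rw [smul_hermiteMeasure] at this
  simpa [div_eq_inv_mul] using this

instance : IsProbabilityMeasure (ENNReal.ofReal (1 / 2) • legendreMeasure) := ⟨by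
  rw [Measure.smul_apply, legendreMeasure, Measure.restrict_apply_univ, Real.volume_Icc,
    smul_eq_mul, ← ENNReal.ofReal_mul (by norm_num)]
  norm_num⟩

theorem ae_legendreMeasure_mem : ∀ᵐ t ∂(ENNReal.ofReal (1 / 2) • legendreMeasure),
    t ∈ Set.Icc (-1 : ℝ) 1 :=
  Measure.ae_smul_measure (ae_restrict_mem measurableSet_Icc) _

theorem integrable_exp_legendre (c : ℝ) :
    Integrable (fun t => Real.exp (c * t)) (ENNReal.ofReal (1 / 2) • legendreMeasure) := by
  have h : IntegrableOn (fun t => Real.exp (c * t)) (Set.Icc (-1) 1) :=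
    ContinuousOn.integrableOn_compact isCompact_Icc (by fun_prop)
  exact Integrable.smul_measure h ENNReal.ofReal_ne_top

theorem integral_smul_legendreMeasure (f : ℝ → ℝ) :
    ∫ t, f ((t + 1) / 2) ∂(ENNReal.ofReal (1 / 2) • legendreMeasure) = ∫ u in (0 : ℝ)..1, f u := by
  rw [integral_smul_measure, legendreMeasure, integral_Icc_eq_integral_Ioc,
    ← intervalIntegral.integral_of_le (by norm_num)]
  have h1 := intervalIntegral.integral_comp_div_add f (a := -1) (b := 1) (c := 2) (by norm_num) (1 / 2)
  have h2 : ∀ t : ℝ, (t + 1) / 2 = t / 2 + 1 / 2 := fun t => by ring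
  simp_rw [h2, h1]
  rw [ENNReal.toReal_ofReal (by norm_num), smul_smul]
  norm_num

theorem IsGaussRule.legendre_div {N : ℕ} {x c : Fin N → ℝ} (h : IsGaussRule legendreMeasure x c) :
    IsGaussRule (ENNReal.ofReal (1 / 2) • legendreMeasure) x (fun n => c n / 2) := by
  have := h.const_mul (c := 1 / 2) (by norm_num)
  simpa [div_eq_inv_mul] using this

/-- Gauss–Legendre approximation of `∫ u in 0..1, C / (C + u ^ β)`. -/
noncomputable def legendreRatio {N : ℕ} (x c : Fin N → ℝ) (β C : ℝ) : ℝ :=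
  ∑ m, c m / 2 * (C / (C + ((x m + 1) / 2) ^ β))

theorem div_add_mem_Icc {C v : ℝ} (hC : 0 < C) (hv : 0 ≤ v) : C / (C + v) ∈ Set.Icc (0 : ℝ) 1 :=
  ⟨by positivity, (div_le_one (by positivity)).2 (by linarith)⟩

/-- A node below -1 would put a negative base into the real power, but every node of nonzero weight
lies in `[-1, 1]`. After clamping, the integrand is continuous in the node on all of ℝ for positive
exponent and `C`, and takes values in `[0, 1]`, as the convergence theorem requires. -/
theorem legendreRatio_eq_max {N : ℕ} {x c : Fin N → ℝ} (h : IsGaussRule legendreMeasure x c)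
    (β C : ℝ) : legendreRatio x c β C =
      ∑ m, c m / 2 * (C / (C + ((max (x m) (-1) + 1) / 2) ^ β)) := by
  refine Finset.sum_congr rfl fun m _ => ?_
  by_cases hm : c m / 2 = 0
  · rw [hm, zero_mul, zero_mul]
  · rw [max_eq_left (h.legendre_div.node_mem_Icc ae_legendreMeasure_mem hm).1]

theorem legendreRatio_mem_Icc {N : ℕ} {x c : Fin N → ℝ} (h : IsGaussRule legendreMeasure x c)
    {β C : ℝ} (hC : 0 < C) : legendreRatio x c β C ∈ Set.Icc (0 : ℝ) 1 := by
  rw [legendreRatio_eq_max h]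
  have hw := h.legendre_div.weight_nonneg
  have h1 : ∀ m, C / (C + ((max (x m) (-1) + 1) / 2) ^ β) ∈ Set.Icc (0 : ℝ) 1 := fun m =>
    div_add_mem_Icc hC (Real.rpow_nonneg (by linarith [le_max_right (x m) (-1)]) _)
  refine ⟨Finset.sum_nonneg fun m _ => mul_nonneg (hw m) (h1 m).1, ?_⟩
  calc _ ≤ ∑ m, c m / 2 := Finset.sum_le_sum fun m _ => mul_le_of_le_one_right (hw m) (h1 m).2
    _ ≤ 1 := h.legendre_div.sum_weight_le.trans_eq probReal_univ

/-- The limit is joint in `N` and `C` because `C` will be evaluated at moving Gauss–Hermite nodes.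
-/
theorem tendsto_legendreRatio {x c : (N : ℕ) → Fin N → ℝ}
    (h : ∀ N, IsGaussRule legendreMeasure (x N) (c N)) {β C : ℝ} (hβ : 0 < β) (hC : 0 < C) :
    Tendsto (fun p : ℕ × ℝ => legendreRatio (x p.1) (c p.1) β p.2) (atTop ×ˢ 𝓝 C)
      (𝓝 (∫ u in (0 : ℝ)..1, C / (C + u ^ β))) := by
  simp_rw [fun N => legendreRatio_eq_max (h N)]
  have hv : ∀ t : ℝ, 0 ≤ ((max t (-1) + 1) / 2) ^ β := fun t =>
    Real.rpow_nonneg (by linarith [le_max_right t (-1)]) _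
  have hint : ∫ u in (0 : ℝ)..1, C / (C + u ^ β) =
      ∫ t, C / (C + ((max t (-1) + 1) / 2) ^ β) ∂(ENNReal.ofReal (1 / 2) • legendreMeasure) := by
    rw [← integral_smul_legendreMeasure]
    exact integral_congr_ae (ae_legendreMeasure_mem.mono fun t ht => by
      simp only [max_eq_left ht.1])
  rw [hint]
  refine IsGaussRule.tendsto_sum_of_continuous_convergence integrable_exp_legendre
    (fun N => (h N).legendre_div) (n := Prod.fst) tendsto_fst
    (F := fun p t => p.2 / (p.2 + ((max t (-1) + 1) / 2) ^ β)) (B := 1) ?_ fun t => ?_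
  · have : ∀ᶠ p : ℕ × ℝ in atTop ×ˢ 𝓝 C, 0 < p.2 :=
      tendsto_snd.eventually (lt_mem_nhds hC)
    refine this.mono fun p hp t => ?_
    have h1 := div_add_mem_Icc hp (hv t)
    exact abs_le.2 ⟨by linarith [h1.1], h1.2⟩
  · have h1 : Tendsto (fun p : (ℕ × ℝ) × ℝ => p.1.2) ((atTop ×ˢ 𝓝 C) ×ˢ 𝓝 t) (𝓝 C) :=
      tendsto_snd.comp tendsto_fst
    have h2 : Continuous fun t : ℝ => ((max t (-1) + 1) / 2) ^ β :=
      Continuous.rpow_const (by fun_prop) fun _ => Or.inr hβ.le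
    have h3 : Tendsto (fun p : (ℕ × ℝ) × ℝ => ((max p.2 (-1) + 1) / 2) ^ β)
        ((atTop ×ˢ 𝓝 C) ×ˢ 𝓝 t) (𝓝 (((max t (-1) + 1) / 2) ^ β)) :=
      (h2.tendsto t).comp tendsto_snd
    exact h1.div (h1.add h3) (by linarith [hv t])

/-! ### Convergence of the quadrature formula -/

namespace SoftFRNetwork

variable {K : ℕ} (net : SoftFRNetwork K)

theorem shadowGain_pos (m s t : ℝ) : 0 < shadowGain m s t := Real.rpow_pos_of_pos (by norm_num) _

theorem continuous_shadowGain (m s : ℝ) : Continuous (shadowGain m s) := by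
  unfold shadowGain
  exact Continuous.rpow continuous_const (by fun_prop) fun _ => Or.inl (by norm_num)

theorem shadowGain_eq_mul_exp (m s t : ℝ) :
    shadowGain m s t = shadowGain m s 0 * Real.exp (√2 * s * Real.log 10 / 10 * t) := by
  unfold shadowGain
  rw [Real.rpow_def_of_pos (by norm_num), Real.rpow_def_of_pos (by norm_num), ← Real.exp_add]
  congr 1
  ring

theorem density_pos (j : Fin K) (s : CellGroup) : 0 < net.density j s := by
  have h1 := net.Delta_gt j
  have h2 := net.lam_pos j
  cases s <;> simp only [density]
  · have : 0 < net.Delta j - 1 := by linarith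
    positivity
  · positivity

theorem ratio_pos (j : Fin K) (s : CellGroup) : 0 < net.ratio j s := by
  cases s
  · exact one_pos
  · exact net.phi_pos j

variable (i j : Fin K) {T r q : ℝ}

theorem cFactor_pos (hT : 0 < T) (hr : 0 < r) (hq : 0 < q) (t s : ℝ) :
    0 < net.cFactor i j T r q t s := by
  have h1 := shadowGain_pos net.muz net.sigmaz t
  have h2 := shadowGain_pos net.muz net.sigmaz s
  have h3 := net.P_pos i
  have h4 := net.P_pos j
  have h5 := net.phi_pos i
  unfold cFactor
  positivity

theorem continuous_cFactor (T r q : ℝ) :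
    Continuous fun p : ℝ × ℝ => net.cFactor i j T r q p.1 p.2 := by
  have h := continuous_shadowGain net.muz net.sigmaz
  unfold cFactor
  exact ((continuous_const.mul ((h.comp continuous_snd).div (h.comp continuous_fst)
    fun p => (shadowGain_pos _ _ _).ne')).mul continuous_const).mul continuous_const

theorem mainTerm_nonneg {C : ℝ} (hC : 0 ≤ C) : 0 ≤ net.mainTerm j C := by
  have ha := net.alpha_gt j
  have h0 : 0 ≤ C ^ (2 / net.alpha j) := Real.rpow_nonneg hC _
  have h1 : 0 < Real.sin (Real.pi * (net.alpha j - 2) / net.alpha j) := by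
    refine Real.sin_pos_of_pos_of_lt_pi ?_ ?_
    · have : 0 < net.alpha j - 2 := by linarith
      positivity
    · rw [div_lt_iff₀ (by linarith)]
      nlinarith [Real.pi_pos]
  unfold mainTerm
  have : 0 < net.alpha j := by linarith
  positivity

theorem continuous_mainTerm : Continuous (net.mainTerm j) := by
  have ha := net.alpha_gt j
  unfold mainTerm
  exact (continuous_const.mul (Real.continuous_rpow_const (by
    have : 0 < net.alpha j := by linarith
    positivity))).div_const _

/-- The exponential rate of `mainTerm` in the shadowing variable of the interfering link. -/
noncomputable def mainRate : ℝ := 2 / net.alpha j * (√2 * net.sigmaz * Real.log 10 / 10)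

/-- `C` is an exponential in `s`, and so is its power `C ^ (2 / α)`. Hence the unbounded part of the
inner integrand is a factor depending on `t` times one exponential, to which `tendsto_sum_exp`
applies. -/
theorem mainTerm_cFactor (hT : 0 < T) (hr : 0 < r) (hq : 0 < q) (t s : ℝ) :
    net.mainTerm j (net.cFactor i j T r q t s) =
      net.mainTerm j (net.cFactor i j T r q t 0) * Real.exp (net.mainRate j * s) := by
  have h1 : net.cFactor i j T r q t s =
      net.cFactor i j T r q t 0 * Real.exp (√2 * net.sigmaz * Real.log 10 / 10 * s) := by
    unfold cFactor
    rw [shadowGain_eq_mul_exp _ _ s]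
    ring
  rw [h1, mainTerm, Real.mul_rpow (net.cFactor_pos i j hT hr hq t 0).le (Real.exp_pos _).le,
    ← Real.exp_mul, mainTerm, mainRate]
  rw [show √2 * net.sigmaz * Real.log 10 / 10 * s * (2 / net.alpha j) =
    2 / net.alpha j * (√2 * net.sigmaz * Real.log 10 / 10) * s by ring]
  ring

theorem integrable_mainTerm (hT : 0 < T) (hr : 0 < r) (hq : 0 < q) (t : ℝ) :
    Integrable (fun s => net.mainTerm j (net.cFactor i j T r q t s)) (gaussianReal 0 (1 / 2)) := by
  rw [funext fun s => net.mainTerm_cFactor i j hT hr hq t s]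
  exact (integrable_exp_gaussian _).const_mul _

theorem fIQuad_eq {NH NL : ℕ} (a w : Fin NH → ℝ) (x c : Fin NL → ℝ) (T r q t : ℝ) :
    net.fIQuad a w x c i j T r q t =
      ∑ n, w n / √Real.pi * net.mainTerm j (net.cFactor i j T r q t (a n)) -
      ∑ n, w n / √Real.pi * legendreRatio x c (net.alpha j / 2) (net.cFactor i j T r q t (a n)) := by
  rw [← Finset.sum_sub_distrib, fIQuad]
  exact Finset.sum_congr rfl fun n _ => mul_sub _ _ _

/-- The main part is nonnegative, and the subtracted part averages numbers of `[0, 1]` with weights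
of total at most 1. The bound is uniform in the orders and in `t`. -/
theorem neg_one_le_fIQuad {NH NL : ℕ} {a w : Fin NH → ℝ} {x c : Fin NL → ℝ}
    (hG : IsGaussRule hermiteMeasure a w) (hL : IsGaussRule legendreMeasure x c)
    (hT : 0 < T) (hr : 0 < r) (hq : 0 < q) (t : ℝ) : -1 ≤ net.fIQuad a w x c i j T r q t := by
  have hw := hG.hermite_div.weight_nonneg
  rw [fIQuad_eq]
  have h1 : 0 ≤ ∑ n, w n / √Real.pi * net.mainTerm j (net.cFactor i j T r q t (a n)) :=
    Finset.sum_nonneg fun n _ => mul_nonneg (hw n)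
      (net.mainTerm_nonneg j (net.cFactor_pos i j hT hr hq _ _).le)
  have h2 : ∑ n, w n / √Real.pi *
      legendreRatio x c (net.alpha j / 2) (net.cFactor i j T r q t (a n)) ≤ 1 := by
    calc _ ≤ ∑ n, w n / √Real.pi := Finset.sum_le_sum fun n _ =>
          mul_le_of_le_one_right (hw n)
            (legendreRatio_mem_Icc hL (net.cFactor_pos i j hT hr hq _ _)).2
      _ ≤ 1 := by simpa using hG.hermite_div.sum_weight_le
  linarith

/-- The integral `∫ u in 0..1, C / (C + u ^ (α / 2))` as a function of `C`. -/
noncomputable def nearRatio (C : ℝ) : ℝ := ∫ u in (0 : ℝ)..1, C / (C + u ^ (net.alpha j / 2))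

theorem nearRatio_mem_Icc {C : ℝ} (hC : 0 < C) : net.nearRatio j C ∈ Set.Icc (0 : ℝ) 1 := by
  have h1 : ∀ u ∈ Set.Icc (0 : ℝ) 1, C / (C + u ^ (net.alpha j / 2)) ∈ Set.Icc (0 : ℝ) 1 :=
    fun u hu => div_add_mem_Icc hC (Real.rpow_nonneg hu.1 _)
  refine ⟨intervalIntegral.integral_nonneg (by norm_num) fun u hu => (h1 u hu).1, ?_⟩
  have := intervalIntegral.norm_integral_le_of_norm_le_const (a := 0) (b := 1) (C := 1)
    (f := fun u : ℝ => C / (C + u ^ (net.alpha j / 2))) fun u hu => by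
      rw [Set.uIoc_of_le (by norm_num)] at hu
      have := h1 u ⟨hu.1.le, hu.2⟩
      rw [Real.norm_of_nonneg this.1]
      exact this.2
  simpa [nearRatio] using (le_abs_self _).trans this

theorem measurable_nearRatio : Measurable (net.nearRatio j) := by
  unfold nearRatio
  simp_rw [intervalIntegral.integral_of_le (zero_le_one' ℝ)]
  refine StronglyMeasurable.measurable (StronglyMeasurable.integral_prod_right
    (f := fun C u : ℝ => C / (C + u ^ (net.alpha j / 2))) (Measurable.stronglyMeasurable ?_))
  fun_prop

theorem integrable_nearRatio (hT : 0 < T) (hr : 0 < r) (hq : 0 < q) (t : ℝ) :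
    Integrable (fun s => net.nearRatio j (net.cFactor i j T r q t s)) (gaussianReal 0 (1 / 2)) := by
  refine Integrable.of_bound ((net.measurable_nearRatio j).comp
    ((net.continuous_cFactor i j T r q).comp (by fun_prop :
      Continuous fun s : ℝ => (t, s))).measurable).aestronglyMeasurable 1 (ae_of_all _ fun s => ?_)
  have := net.nearRatio_mem_Icc j (net.cFactor_pos i j hT hr hq t s)
  rw [Real.norm_of_nonneg this.1]
  exact this.2

theorem fI_eq_integral (T r q t : ℝ) : net.fI i j T r q t =
    ∫ s, (net.mainTerm j (net.cFactor i j T r q t s) -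
      net.nearRatio j (net.cFactor i j T r q t s)) ∂(gaussianReal 0 (1 / 2)) :=
  integral_exp_neg_sq_div_mul _

theorem measurable_fI (T r q : ℝ) : Measurable (net.fI i j T r q) := by
  have : net.fI i j T r q = fun t => ∫ s, (net.mainTerm j (net.cFactor i j T r q t s) -
      net.nearRatio j (net.cFactor i j T r q t s)) ∂(gaussianReal 0 (1 / 2)) :=
    funext fun t => net.fI_eq_integral i j T r q t
  rw [this]
  have hc := (net.continuous_cFactor i j T r q).measurable
  exact (StronglyMeasurable.integral_prod_right (Measurable.stronglyMeasurable
    (((net.continuous_mainTerm j).measurable.comp hc).sub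
      ((net.measurable_nearRatio j).comp hc)))).measurable

section Quadrature

variable {a w x c : (N : ℕ) → Fin N → ℝ}

/-- Again the limit is joint in the orders and in `t`, since the outer rule samples at moving nodes.
The exponential part factors through `t`; the bounded part is a continuously converging family. -/
theorem tendsto_fIQuad (hG : ∀ N, IsGaussRule hermiteMeasure (a N) (w N))
    (hL : ∀ N, IsGaussRule legendreMeasure (x N) (c N))
    (hT : 0 < T) (hr : 0 < r) (hq : 0 < q) (t : ℝ) :
    Tendsto (fun p : (ℕ × ℕ) × ℝ =>
      net.fIQuad (a p.1.1) (w p.1.1) (x p.1.2) (c p.1.2) i j T r q p.2)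
      ((atTop ×ˢ atTop) ×ˢ 𝓝 t) (𝓝 (net.fI i j T r q t)) := by
  simp_rw [fIQuad_eq]
  rw [fI_eq_integral, integral_sub (net.integrable_mainTerm i j hT hr hq t)
    (net.integrable_nearRatio i j hT hr hq t)]
  have hn : Tendsto (fun p : (ℕ × ℕ) × ℝ => p.1.1) ((atTop ×ˢ atTop) ×ˢ 𝓝 t) atTop :=
    tendsto_fst.comp tendsto_fst
  refine Tendsto.sub ?_ ?_
  · have h1 : ∀ p : (ℕ × ℕ) × ℝ, ∑ n, w p.1.1 n / √Real.pi *
        net.mainTerm j (net.cFactor i j T r q p.2 (a p.1.1 n)) =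
        net.mainTerm j (net.cFactor i j T r q p.2 0) *
          ∑ n, w p.1.1 n / √Real.pi * Real.exp (net.mainRate j * a p.1.1 n) := fun p => by
      rw [Finset.mul_sum]
      refine Finset.sum_congr rfl fun n _ => ?_
      rw [net.mainTerm_cFactor i j hT hr hq]
      ring
    have h0 : ∫ s, net.mainTerm j (net.cFactor i j T r q t s) ∂(gaussianReal 0 (1 / 2)) =
        net.mainTerm j (net.cFactor i j T r q t 0) *
          ∫ s, Real.exp (net.mainRate j * s) ∂(gaussianReal 0 (1 / 2)) := by
      rw [← integral_const_mul]
      exact integral_congr_ae (ae_of_all _ fun s => net.mainTerm_cFactor i j hT hr hq t s)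
    rw [h0]
    have h2 : Continuous fun t => net.mainTerm j (net.cFactor i j T r q t 0) :=
      (net.continuous_mainTerm j).comp
        ((net.continuous_cFactor i j T r q).comp₂ continuous_id continuous_const)
    have h3 : Tendsto (fun N => ∑ n, w N n / √Real.pi * Real.exp (net.mainRate j * a N n)) atTop
        (𝓝 (∫ s, Real.exp (net.mainRate j * s) ∂(gaussianReal 0 (1 / 2)))) :=
      IsGaussRule.tendsto_sum_exp integrable_exp_gaussian (fun N => (hG N).hermite_div) _
    have h4 : Tendsto (fun p : (ℕ × ℕ) × ℝ => net.mainTerm j (net.cFactor i j T r q p.2 0))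
        ((atTop ×ˢ atTop) ×ˢ 𝓝 t) (𝓝 (net.mainTerm j (net.cFactor i j T r q t 0))) :=
      Tendsto.comp (h2.tendsto t) tendsto_snd
    have h5 : Tendsto (fun p : (ℕ × ℕ) × ℝ => ∑ n, w p.1.1 n / √Real.pi *
        Real.exp (net.mainRate j * a p.1.1 n)) ((atTop ×ˢ atTop) ×ˢ 𝓝 t)
        (𝓝 (∫ s, Real.exp (net.mainRate j * s) ∂(gaussianReal 0 (1 / 2)))) :=
      h3.comp hn
    exact (h4.mul h5).congr fun p => (h1 p).symm
  · refine IsGaussRule.tendsto_sum_of_continuous_convergence integrable_exp_gaussian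
      (fun N => (hG N).hermite_div) hn
      (F := fun p s => legendreRatio (x p.1.2) (c p.1.2) (net.alpha j / 2)
        (net.cFactor i j T r q p.2 s)) (B := 1) (Eventually.of_forall fun p s => ?_) fun s => ?_
    · have := legendreRatio_mem_Icc (β := net.alpha j / 2) (hL p.1.2)
        (net.cFactor_pos i j hT hr hq p.2 s)
      exact abs_le.2 ⟨by linarith [this.1], this.2⟩
    · have hβ : 0 < net.alpha j / 2 := by linarith [net.alpha_gt j]
      have h1 : Tendsto (fun p : ℝ × ℝ => net.cFactor i j T r q p.1 p.2) (𝓝 t ×ˢ 𝓝 s)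
          (𝓝 (net.cFactor i j T r q t s)) := by
        rw [← nhds_prod_eq]
        exact (net.continuous_cFactor i j T r q).tendsto (t, s)
      have h2 : Tendsto (fun p : ((ℕ × ℕ) × ℝ) × ℝ => (p.1.2, p.2))
          (((atTop ×ˢ atTop) ×ˢ 𝓝 t) ×ˢ 𝓝 s) (𝓝 t ×ˢ 𝓝 s) :=
        Tendsto.prodMk (tendsto_snd.comp tendsto_fst) tendsto_snd
      have h4 := h1.comp h2
      simp only [Function.comp_def] at h4
      have h3 : Tendsto (fun p : ((ℕ × ℕ) × ℝ) × ℝ =>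
          (p.1.1.2, net.cFactor i j T r q p.1.2 p.2))
          (((atTop ×ˢ atTop) ×ˢ 𝓝 t) ×ˢ 𝓝 s) (atTop ×ˢ 𝓝 (net.cFactor i j T r q t s)) :=
        Tendsto.prodMk (tendsto_snd.comp (tendsto_fst.comp tendsto_fst)) h4
      have h5 := (tendsto_legendreRatio hL hβ (net.cFactor_pos i j hT hr hq t s)).comp h3
      simp only [Function.comp_def] at h5
      exact h5

theorem tendsto_coverageQuad (hG : ∀ N, IsGaussRule hermiteMeasure (a N) (w N))
    (hL : ∀ N, IsGaussRule legendreMeasure (x N) (c N)) (hT : 0 < T) (hr : 0 < r) :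
    Tendsto (fun N : ℕ × ℕ => net.coverageQuad (a N.1) (w N.1) (x N.2) (c N.2) i T r)
      (atTop ×ˢ atTop) (𝓝 (net.coverageExact i T r)) := by
  rw [coverageExact, integral_exp_neg_sq_div_mul]
  refine IsGaussRule.tendsto_sum_of_continuous_convergence integrable_exp_gaussian
      (fun N => (hG N).hermite_div) tendsto_fst
      (F := fun N t => net.coverageTerm i T r t fun j q =>
        net.fIQuad (a N.1) (w N.1) (x N.2) (c N.2) i j T r q t)
      -- The bound arises by replacing the noise factor by 1 and each inner quadrature by its lower
      -- bound -1.
      (B := Real.exp (Real.pi * r ^ 2 * ∑ j, net.eps j *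
        (net.density j .center + net.density j .edge)))
      (Eventually.of_forall fun N t => ?_) fun t => ?_
  · have hnoise := net.noise_nonneg
    have h1 := shadowGain_pos net.muz net.sigmaz t
    have h2 := net.P_pos i
    have h3 := net.phi_pos i
    rw [coverageTerm, abs_of_pos (by positivity)]
    refine (mul_le_of_le_one_left (by positivity) (Real.exp_le_one_iff.2 ?_)).trans
      (Real.exp_le_exp.2 ?_)
    · rw [snr, neg_nonpos]
      positivity
    · rw [← mul_neg, ← Finset.sum_neg_distrib]
      gcongr with j
      rw [← mul_neg]
      refine mul_le_mul_of_nonneg_left ?_ (net.eps_nonneg j)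
      have h4 := net.neg_one_le_fIQuad i j (hG N.1) (hL N.2) hT hr one_pos t
      have h5 := net.neg_one_le_fIQuad i j (hG N.1) (hL N.2) hT hr (net.phi_pos j) t
      nlinarith [net.density_pos j .center, net.density_pos j .edge]
  · unfold coverageTerm
    refine Tendsto.mul ?_ ?_
    · have h1 : Continuous fun t => Real.exp (-(T * r ^ net.alpha i /
          shadowGain net.muz net.sigmaz t * (1 / (net.phi i * net.snr i)))) :=
        Real.continuous_exp.comp (((continuous_const.div (continuous_shadowGain _ _)
          fun t => (shadowGain_pos _ _ t).ne').mul continuous_const).neg)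
      exact (h1.tendsto t).comp tendsto_snd
    · refine (Real.continuous_exp.tendsto _).comp (Tendsto.neg (Tendsto.const_mul _
        (tendsto_finsetSum _ fun j _ => Tendsto.const_mul _ (Tendsto.add
          (Tendsto.const_mul _ ?_) (Tendsto.const_mul _ ?_)))))
      · exact net.tendsto_fIQuad i j hG hL hT hr one_pos t
      · exact net.tendsto_fIQuad i j hG hL hT hr (net.phi_pos j) t

end Quadrature

end SoftFRNetwork

/-! ### The Laplace functional of a Poisson process -/

/-- The function `exp (-x)` on `[0, ∞]`. -/
noncomputable def expNeg (x : ℝ≥0∞) : ℝ≥0∞ := EReal.exp (-(x : EReal))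

theorem expNeg_zero : expNeg 0 = 1 := by simp [expNeg]

theorem expNeg_top : expNeg ∞ = 0 := by simp [expNeg]

theorem expNeg_add (x y : ℝ≥0∞) : expNeg (x + y) = expNeg x * expNeg y := by
  rw [expNeg, expNeg, expNeg, EReal.coe_ennreal_add, EReal.neg_add (by simp) (by simp),
    sub_eq_add_neg, EReal.exp_add]

theorem expNeg_sum {ι : Type*} (s : Finset ι) (x : ι → ℝ≥0∞) :
    expNeg (∑ i ∈ s, x i) = ∏ i ∈ s, expNeg (x i) := by
  classical
  induction s using Finset.induction_on with
  | empty => simp [expNeg_zero]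
  | insert a s ha ih => rw [Finset.sum_insert ha, Finset.prod_insert ha, expNeg_add, ih]

theorem expNeg_mul_natCast (x : ℝ≥0∞) (k : ℕ) : expNeg (x * k) = expNeg x ^ k := by
  simpa [mul_comm] using expNeg_sum (Finset.range k) fun _ => x

theorem expNeg_ofReal {x : ℝ} (hx : 0 ≤ x) :
    expNeg (ENNReal.ofReal x) = ENNReal.ofReal (Real.exp (-x)) := by
  rw [expNeg, EReal.coe_ennreal_ofReal, max_eq_left hx, ← EReal.coe_neg, EReal.exp_coe]

theorem expNeg_le_one (x : ℝ≥0∞) : expNeg x ≤ 1 := by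
  rw [expNeg, EReal.exp_le_one_iff]
  simpa using EReal.coe_ennreal_nonneg x

theorem continuous_expNeg : Continuous expNeg :=
  ENNReal.continuous_exp.comp (continuous_neg.comp continuous_coe_ennreal_ereal)

theorem measurable_expNeg : Measurable expNeg := continuous_expNeg.measurable

theorem antitone_expNeg : Antitone expNeg := fun x y h => by
  rw [expNeg, expNeg, EReal.exp_le_exp_iff, EReal.neg_le_neg_iff]
  exact_mod_cast h

theorem expNeg_toENNReal_neg_log {y : ℝ≥0∞} (hy : y ≤ 1) :
    expNeg (-ENNReal.log y).toENNReal = y := by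
  rw [expNeg, EReal.coe_toENNReal, neg_neg, ENNReal.exp_log]
  have h : ENNReal.log y ≤ 0 := ENNReal.log_le_zero_iff.2 hy
  simpa using EReal.neg_le_neg_iff.2 h

namespace IsPoissonProcess

variable {Ω E : Type*} [MeasurableSpace Ω] [MeasurableSpace E] {μ : Measure Ω}
  {X : ℕ → Ω → E} {Λ : Measure E}

/-- The counting measure of a sequence of points. -/
noncomputable def _root_.pointMeasure (x : ℕ → E) : Measure E :=
  Measure.sum fun n => Measure.dirac (x n)

theorem _root_.lintegral_pointMeasure (x : ℕ → E) {F : E → ℝ≥0∞} (hF : Measurable F) :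
    ∫⁻ y, F y ∂(pointMeasure x) = ∑' n, F (x n) := by
  rw [pointMeasure, lintegral_sum_measure]
  simp_rw [lintegral_dirac' _ hF]

theorem _root_.pointMeasure_apply (x : ℕ → E) {B : Set E} (hB : MeasurableSet B) :
    pointMeasure x B = ({n | x n ∈ B}.encard : ℝ≥0∞) := by
  rw [pointMeasure, Measure.sum_apply _ hB, ← ENNReal.tsum_set_one,
    tsum_subtype {n | x n ∈ B} fun _ => (1 : ℝ≥0∞)]
  refine tsum_congr fun n => ?_
  rw [Measure.dirac_apply' _ hB]
  by_cases hn : x n ∈ B <;> simp [hn]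

theorem measurable_count (h : IsPoissonProcess μ X Λ) {B : Set E} (hB : MeasurableSet B) :
    Measurable fun ω => {n | X n ω ∈ B}.encard := by
  have h1 : Measurable fun ω => (({n | X n ω ∈ B}.encard : ℕ∞) : ℝ≥0∞) := by
    simp_rw [← pointMeasure_apply (fun n => X n _) hB, ← lintegral_indicator_one hB,
      lintegral_pointMeasure _ (measurable_one.indicator hB)]
    exact Measurable.tsum fun n => (measurable_one.indicator hB).comp (h.measurable n)
  refine measurable_to_countable' fun k => ?_
  have : (fun ω => {n | X n ω ∈ B}.encard) ⁻¹' {k} =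
      (fun ω => (({n | X n ω ∈ B}.encard : ℕ∞) : ℝ≥0∞)) ⁻¹' {(k : ℝ≥0∞)} := by
    ext ω
    simp
  rw [this]
  exact h1 (measurableSet_singleton _)

/-- Laplace transform of the number of points in a set of finite intensity. -/
theorem lintegral_expNeg_count [IsProbabilityMeasure μ] (h : IsPoissonProcess μ X Λ) {B : Set E}
    (hB : MeasurableSet B) (hΛ : Λ B ≠ ∞) (c : ℝ≥0∞) :
    ∫⁻ ω, expNeg (c * ({n | X n ω ∈ B}.encard : ℝ≥0∞)) ∂μ = expNeg ((1 - expNeg c) * Λ B) := by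
  set m := (Λ B).toReal with hm
  have hm0 : 0 ≤ m := ENNReal.toReal_nonneg
  set A : ℕ → Set Ω := fun k => {ω | {n | X n ω ∈ B}.encard = (k : ℕ∞)} with hA
  have hAm : ∀ k, MeasurableSet (A k) := fun k =>
    h.measurable_count hB (measurableSet_singleton (k : ℕ∞))
  have hAd : Pairwise (Function.onFun Disjoint A) := fun k l hkl =>
    Set.disjoint_left.2 fun ω h1 h2 => hkl (by
      simp only [hA, Set.mem_ofPred_eq] at h1 h2
      exact_mod_cast h1.symm.trans h2)
  have hexp : ∀ y : ℝ, HasSum (fun k : ℕ => y ^ k / (k.factorial : ℝ)) (Real.exp y) := fun y => by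
    rw [Real.exp_eq_exp_ℝ]
    exact NormedSpace.expSeries_div_hasSum_exp y
  -- The probability generating function of the Poisson law. At `v = 1` it shows that the count is
  -- almost surely finite; at `v = exp (-c)` it gives the transform.
  have hsum : ∀ v : ℝ, 0 ≤ v → ∑' k, ENNReal.ofReal v ^ k * μ (A k) =
      ENNReal.ofReal (Real.exp (-(m * (1 - v)))) := fun v hv => by
    have h1 : ∀ k : ℕ, ENNReal.ofReal v ^ k * μ (A k) =
        ENNReal.ofReal (Real.exp (-m) * ((m * v) ^ k / (k.factorial : ℝ))) := fun k => by
      rw [h.count_law B hB hΛ k, ← ENNReal.ofReal_pow hv, ← ENNReal.ofReal_mul (by positivity),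
        mul_pow]
      congr 1
      ring
    have h2 := (hexp (m * v)).mul_left (Real.exp (-m))
    simp_rw [h1]
    rw [← ENNReal.ofReal_tsum_of_nonneg (fun k => by positivity) h2.summable, h2.tsum_eq,
      ← Real.exp_add]
    congr 2
    ring
  have hfull : μ (⋃ k, A k)ᶜ = 0 := by
    rw [prob_compl_eq_zero_iff (MeasurableSet.iUnion hAm), measure_iUnion hAd hAm]
    simpa using hsum 1 zero_le_one
  have hv1 : expNeg c ≤ 1 := expNeg_le_one c
  have hv : expNeg c = ENNReal.ofReal (expNeg c).toReal :=
    (ENNReal.ofReal_toReal (ne_top_of_le_ne_top ENNReal.one_ne_top hv1)).symm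
  have hv2 : (expNeg c).toReal ≤ 1 := ENNReal.toReal_mono ENNReal.one_ne_top hv1
  rw [← setLIntegral_univ, ← Set.union_compl_self (⋃ k, A k),
    lintegral_union (MeasurableSet.iUnion hAm).compl disjoint_compl_right,
    Measure.restrict_zero_set hfull, lintegral_zero_measure, add_zero, lintegral_iUnion hAm hAd]
  have h1 : ∀ k, ∫⁻ ω in A k, expNeg (c * ({n | X n ω ∈ B}.encard : ℝ≥0∞)) ∂μ =
      ENNReal.ofReal (expNeg c).toReal ^ k * μ (A k) := fun k => by
    rw [← hv, ← setLIntegral_const]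
    refine setLIntegral_congr_fun (hAm k) fun ω hω => ?_
    simp only [hA, Set.mem_ofPred_eq] at hω
    rw [hω, ENat.toENNReal_coe, expNeg_mul_natCast]
  simp_rw [h1]
  rw [hsum _ ENNReal.toReal_nonneg, ← expNeg_ofReal (mul_nonneg hm0 (by linarith)), mul_comm m,
    ENNReal.ofReal_mul (by linarith), hm, ENNReal.ofReal_toReal hΛ,
    ENNReal.ofReal_sub _ ENNReal.toReal_nonneg, ← hv, ENNReal.ofReal_one]

/-- The sum over the points is a linear combination of the counts in the level sets. These are
disjoint, so the counts are independent and the transform factors. The level 0 may have infinite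
intensity; its factor is 1 on both sides. -/
theorem lintegral_expNeg_tsum_simpleFunc [IsProbabilityMeasure μ] (h : IsPoissonProcess μ X Λ)
    (f : SimpleFunc E ℝ≥0∞) (hf : ∀ c ≠ 0, Λ (f ⁻¹' {c}) ≠ ∞) :
    ∫⁻ ω, expNeg (∑' n, f (X n ω)) ∂μ = expNeg (∫⁻ x, (1 - expNeg (f x)) ∂Λ) := by
  have hfm : ∀ c, MeasurableSet (f ⁻¹' {c}) := fun c => f.measurableSet_preimage _
  have h1 : ∀ ω, expNeg (∑' n, f (X n ω)) =
      ∏ c ∈ f.range, expNeg (c * ({n | X n ω ∈ f ⁻¹' {c}}.encard : ℝ≥0∞)) := fun ω => by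
    rw [← lintegral_pointMeasure (fun n => X n ω) f.measurable, f.lintegral_eq_lintegral,
      SimpleFunc.lintegral, expNeg_sum]
    exact Finset.prod_congr rfl fun c _ => by rw [pointMeasure_apply _ (hfm c)]
  have h2 : ∫⁻ x, (1 - expNeg (f x)) ∂Λ =
      ∑ c ∈ f.range, (1 - expNeg c) * Λ (f ⁻¹' {c}) := by
    rw [← SimpleFunc.map_lintegral, ← SimpleFunc.lintegral_eq_lintegral]
    rfl
  simp_rw [h1]
  rw [h2, expNeg_sum]
  let e := f.range.equivFin
  let Y : Fin f.range.card → Ω → ℝ≥0∞ := fun l ω =>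
    expNeg ((e.symm l : ℝ≥0∞) * ({n | X n ω ∈ f ⁻¹' {(e.symm l : ℝ≥0∞)}}.encard : ℝ≥0∞))
  have hind : iIndepFun Y μ := by
    have h3 := h.count_indep f.range.card (fun l => f ⁻¹' {(e.symm l : ℝ≥0∞)})
      (fun l => hfm _) fun k l hkl => by
        refine Disjoint.preimage f (Set.disjoint_singleton.2 fun h4 => hkl ?_)
        exact e.symm.injective (Subtype.ext h4)
    exact h3.comp (fun l k => expNeg ((e.symm l : ℝ≥0∞) * (k : ℝ≥0∞)))
      fun l => Measurable.of_discrete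
  have hYm : ∀ l, Measurable (Y l) := fun l =>
    (Measurable.of_discrete (f := fun k : ℕ∞ => expNeg ((e.symm l : ℝ≥0∞) * (k : ℝ≥0∞)))).comp
      (h.measurable_count (hfm _))
  have h4 := lintegral_prod_eq_prod_lintegral_of_indepFun Finset.univ Y hind hYm
  have h5 : ∀ g : ℝ≥0∞ → ℝ≥0∞, ∏ c ∈ f.range, g c = ∏ l, g (e.symm l) := fun g => by
    rw [← Finset.prod_coe_sort]
    exact (Equiv.prod_comp e.symm fun c : f.range => g c).symm
  simp_rw [h5]
  rw [h4]
  refine Finset.prod_congr rfl fun l _ => ?_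
  by_cases hc : (e.symm l : ℝ≥0∞) = 0
  · simp only [Y]
    rw [hc]
    simp [expNeg_zero]
  · exact h.lintegral_expNeg_count (hfm _) (hf _ hc) _

/-- The Laplace functional of a Poisson point process. -/
theorem lintegral_expNeg_tsum [IsProbabilityMeasure μ] [SigmaFinite Λ]
    (h : IsPoissonProcess μ X Λ) {F : E → ℝ≥0∞} (hF : Measurable F) :
    ∫⁻ ω, expNeg (∑' n, F (X n ω)) ∂μ = expNeg (∫⁻ x, (1 - expNeg (F x)) ∂Λ) := by
  -- Restricting to sets of finite intensity that exhaust the space gives every nonzero level set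
  -- finite intensity, as the simple case demands.
  let f : ℕ → SimpleFunc E ℝ≥0∞ := fun k =>
    (SimpleFunc.eapprox F k).restrict (spanningSets Λ k)
  have hfe : ∀ k x, f k x = (spanningSets Λ k).indicator (SimpleFunc.eapprox F k) x := fun k x =>
    SimpleFunc.restrict_apply _ (measurableSet_spanningSets Λ k) x
  have hmono : ∀ x, Monotone fun k => f k x := fun x k l hkl => by
    simp only [hfe]
    refine (Set.indicator_le_indicator_of_subset (monotone_spanningSets Λ hkl)
      (fun _ => zero_le) x).trans (Set.indicator_le_indicator ?_)
    exact SimpleFunc.monotone_eapprox F hkl x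
  have hlim : ∀ x, Tendsto (fun k => f k x) atTop (𝓝 (F x)) := fun x => by
    refine (SimpleFunc.tendsto_eapprox hF x).congr' ?_
    filter_upwards [eventually_ge_atTop (spanningSetsIndex Λ x)] with k hk
    rw [hfe, Set.indicator_of_mem (mem_spanningSets_of_index_le Λ x hk)]
  have hfin : ∀ k, ∀ c ≠ 0, Λ (f k ⁻¹' {c}) ≠ ∞ := fun k c hc => by
    refine ne_top_of_le_ne_top (measure_spanningSets_lt_top Λ k).ne (measure_mono fun x hx => ?_)
    by_contra hx2
    refine hc ?_
    rw [← Set.mem_singleton_iff.1 (Set.mem_preimage.1 hx), hfe, Set.indicator_of_notMem hx2]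
  have h1 : Tendsto (fun k => ∫⁻ ω, expNeg (∑' n, f k (X n ω)) ∂μ) atTop
      (𝓝 (∫⁻ ω, expNeg (∑' n, F (X n ω)) ∂μ)) := by
    refine tendsto_lintegral_of_dominated_convergence (fun _ => 1) (fun k => ?_)
      (fun k => ae_of_all _ fun ω => expNeg_le_one _) (by simp) (ae_of_all _ fun ω => ?_)
    · exact measurable_expNeg.comp (Measurable.tsum fun n =>
        (f k).measurable.comp (h.measurable n))
    · refine (continuous_expNeg.tendsto _).comp ?_
      rw [← lintegral_pointMeasure (fun n => X n ω) hF]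
      simp_rw [← lintegral_pointMeasure (fun n => X n ω) (f _).measurable]
      exact lintegral_tendsto_of_tendsto_of_monotone (fun k => (f k).measurable.aemeasurable)
        (ae_of_all _ hmono) (ae_of_all _ hlim)
  have h2 : Tendsto (fun k => expNeg (∫⁻ x, (1 - expNeg (f k x)) ∂Λ)) atTop
      (𝓝 (expNeg (∫⁻ x, (1 - expNeg (F x)) ∂Λ))) := by
    refine (continuous_expNeg.tendsto _).comp (lintegral_tendsto_of_tendsto_of_monotone
      (fun k => ?_) (ae_of_all _ fun x => ?_) (ae_of_all _ fun x => ?_))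
    · exact (measurable_const.sub (measurable_expNeg.comp (f k).measurable)).aemeasurable
    · exact fun k l hkl => tsub_le_tsub_left (antitone_expNeg (hmono x hkl)) 1
    · exact ENNReal.Tendsto.sub tendsto_const_nhds
        ((continuous_expNeg.tendsto _).comp (hlim x)) (Or.inl ENNReal.one_ne_top)
  refine tendsto_nhds_unique h1 (h2.congr fun k => ?_)
  exact (h.lintegral_expNeg_tsum_simpleFunc (f k) (hfin k)).symm

end IsPoissonProcess

/-! ### Independence of the sources and averaging of the marks -/

/-- Integration of a function of two independent variables, one after the other. -/
theorem ProbabilityTheory.IndepFun.lintegral_eq_lintegral_lintegral {Ω S T : Type*}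
    [MeasurableSpace Ω] [MeasurableSpace S] [MeasurableSpace T] {μ : Measure Ω}
    [IsProbabilityMeasure μ] {X : Ω → S} {Y : Ω → T} (h : IndepFun X Y μ) (hX : Measurable X)
    (hY : Measurable Y) {F : S × T → ℝ≥0∞} (hF : Measurable F) :
    ∫⁻ ω, F (X ω, Y ω) ∂μ = ∫⁻ ω, ∫⁻ ω', F (X ω, Y ω') ∂μ ∂μ := by
  have := Measure.isProbabilityMeasure_map (μ := μ) hX.aemeasurable
  have := Measure.isProbabilityMeasure_map (μ := μ) hY.aemeasurable
  rw [← lintegral_map hF (hX.prodMk hY),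
    (indepFun_iff_map_prod_eq_prod_map_map hX.aemeasurable hY.aemeasurable).1 h,
    lintegral_prod _ hF.aemeasurable, lintegral_map hF.lintegral_prod_right' hX]
  exact lintegral_congr fun ω => lintegral_map (hF.comp measurable_prodMk_left) hY

/-- Averaging a finite product over marks that are independent of each other and of `X`. -/
theorem lintegral_prod_of_indep_marks {Ω S M κ : Type*} [MeasurableSpace Ω] [MeasurableSpace S]
    [MeasurableSpace M] {μ : Measure Ω} [IsProbabilityMeasure μ] {X : Ω → S} {U : κ → Ω → M}
    (hX : Measurable X) (hU : ∀ k, Measurable (U k)) (hind : iIndepFun U μ)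
    (hXU : IndepFun X (fun ω k => U k ω) μ) {ψ : κ → S × M → ℝ≥0∞} (hψ : ∀ k, Measurable (ψ k))
    (s : Finset κ) :
    ∫⁻ ω, ∏ k ∈ s, ψ k (X ω, U k ω) ∂μ =
      ∫⁻ ω, ∏ k ∈ s, ∫⁻ u, ψ k (X ω, u) ∂(μ.map (U k)) ∂μ := by
  have hF : Measurable fun p : S × (κ → M) => ∏ k ∈ s, ψ k (p.1, p.2 k) :=
    Finset.measurable_fun_prod _ fun k _ => (hψ k).comp (by fun_prop)
  rw [hXU.lintegral_eq_lintegral_lintegral hX (measurable_pi_lambda _ hU) hF]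
  refine lintegral_congr fun ω => ?_
  have hm : ∀ k, Measurable fun u => ψ k (X ω, u) := fun k => (hψ k).comp measurable_prodMk_left
  have h1 := lintegral_prod_eq_prod_lintegral_of_indepFun s (fun k ω' => ψ k (X ω, U k ω'))
    (hind.comp (fun k u => ψ k (X ω, u)) hm) fun k => (hm k).comp (hU k)
  dsimp only
  rw [h1]
  exact Finset.prod_congr rfl fun k _ => (lintegral_map (hm k) (hU k)).symm

instance : DecidableEq CellGroup := fun a b => by
  cases a <;> cases b <;> first | exact isTrue rfl | exact isFalse nofun

instance : Fintype CellGroup := ⟨{.center, .edge}, fun s => by cases s <;> simp⟩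

namespace Downlink

variable {K : ℕ} {net : SoftFRNetwork K} {Ω : Type*} [MeasurableSpace Ω] {μ : Measure Ω}
  (D : Downlink net μ)

/-- The σ-algebra generated by a source of randomness. -/
@[reducible] def sourceSpace (a : RandomSource K) : MeasurableSpace Ω := match a with
  | .serving => MeasurableSpace.comap D.servingGain inferInstance
  | .positions j s => MeasurableSpace.comap (fun ω n => D.pos j s n ω) inferInstance
  | .gain j s n => MeasurableSpace.comap (D.gain j s n) inferInstance
  | .indicator j s n => MeasurableSpace.comap (D.tau j s n) inferInstance

theorem iIndep_sourceSpace : iIndep D.sourceSpace μ := D.indep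

/-- All positions. -/
def allPos (ω : Ω) : Fin K × CellGroup → ℕ → EuclideanSpace ℝ (Fin 2) :=
  fun g n => D.pos g.1 g.2 n ω

theorem measurable_posSeq (g : Fin K × CellGroup) : Measurable fun ω n => D.pos g.1 g.2 n ω :=
  measurable_pi_lambda _ fun n => (D.pos_poisson g.1 g.2).measurable n

theorem measurable_allPos : Measurable D.allPos :=
  measurable_pi_lambda _ fun g => D.measurable_posSeq g

/-- All gains of interfering links. -/
def allGain (ω : Ω) : (Fin K × CellGroup) × ℕ → ℝ := fun k => D.gain k.1.1 k.1.2 k.2 ω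

theorem measurable_allGain : Measurable D.allGain :=
  measurable_pi_lambda _ fun k => D.gain_measurable k.1.1 k.1.2 k.2

/-- All indicators. -/
def allTau (ω : Ω) : (Fin K × CellGroup) × ℕ → ℝ := fun k => D.tau k.1.1 k.1.2 k.2 ω

theorem measurable_allTau : Measurable D.allTau :=
  measurable_pi_lambda _ fun k => D.tau_measurable k.1.1 k.1.2 k.2

theorem sourceSpace_le (a : RandomSource K) : D.sourceSpace a ≤ ‹MeasurableSpace Ω› := by
  cases a with
  | serving => exact D.servingGain_measurable.comap_le
  | positions j s => exact (D.measurable_posSeq (j, s)).comap_le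
  | gain j s n => exact (D.gain_measurable j s n).comap_le
  | indicator j s n => exact (D.tau_measurable j s n).comap_le

variable {D} in
theorem measurable_allPos_iSup {S : Set (RandomSource K)} (hS : ∀ j s, .positions j s ∈ S) :
    Measurable[⨆ a ∈ S, D.sourceSpace a] D.allPos :=
  @measurable_pi_lambda _ _ _ (_) _ _ fun g =>
    (comap_measurable fun ω n => D.pos g.1 g.2 n ω).mono
      (le_iSup₂_of_le (RandomSource.positions g.1 g.2) (hS _ _) le_rfl) le_rfl

variable {D} in
theorem measurable_allGain_iSup {S : Set (RandomSource K)} (hS : ∀ j s n, .gain j s n ∈ S) :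
    Measurable[⨆ a ∈ S, D.sourceSpace a] D.allGain :=
  @measurable_pi_lambda _ _ _ (_) _ _ fun k =>
    (comap_measurable (D.gain k.1.1 k.1.2 k.2)).mono
      (le_iSup₂_of_le (RandomSource.gain k.1.1 k.1.2 k.2) (hS _ _ _) le_rfl) le_rfl

variable {D} in
theorem measurable_allTau_iSup {S : Set (RandomSource K)} (hS : ∀ j s n, .indicator j s n ∈ S) :
    Measurable[⨆ a ∈ S, D.sourceSpace a] D.allTau :=
  @measurable_pi_lambda _ _ _ (_) _ _ fun k =>
    (comap_measurable (D.tau k.1.1 k.1.2 k.2)).mono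
      (le_iSup₂_of_le (RandomSource.indicator k.1.1 k.1.2 k.2) (hS _ _ _) le_rfl) le_rfl

/-- Disjoint sets of sources generate independent σ-algebras, so independence of two functions
follows by listing the sources each depends on. -/
theorem indepFun_of_sources {α β : Type*} [MeasurableSpace α] [MeasurableSpace β]
    {S T : Set (RandomSource K)} (hST : Disjoint S T) {X : Ω → α} {Y : Ω → β}
    (hX : Measurable[⨆ a ∈ S, D.sourceSpace a] X) (hY : Measurable[⨆ a ∈ T, D.sourceSpace a] Y) :
    IndepFun X Y μ :=
  (IndepFun_iff_Indep _ _ _).2 (indep_of_indep_of_le_left (indep_of_indep_of_le_right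
    (indep_iSup_of_disjoint D.sourceSpace_le D.iIndep_sourceSpace hST) hY.comap_le) hX.comap_le)

theorem indepFun_pos_gain : IndepFun D.allPos D.allGain μ :=
  D.indepFun_of_sources (S := {a | ∃ j s, a = .positions j s}) (T := {a | ∃ j s n, a = .gain j s n})
    (Set.disjoint_left.2 fun a => by rintro ⟨j, s, rfl⟩ ⟨j', s', n, h⟩; cases h)
    (measurable_allPos_iSup fun j s => ⟨j, s, rfl⟩)
    (measurable_allGain_iSup fun j s n => ⟨j, s, n, rfl⟩)

theorem indepFun_pos_gain_tau : IndepFun (fun ω => (D.allPos ω, D.allGain ω)) D.allTau μ :=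
  D.indepFun_of_sources (S := {a | ∀ j s n, a ≠ .indicator j s n})
    (T := {a | ∃ j s n, a = .indicator j s n})
    (Set.disjoint_left.2 fun _ h => by rintro ⟨j', s', n, h'⟩; exact h _ _ _ h')
    (Measurable.prodMk (measurable_allPos_iSup fun _ _ _ _ _ => nofun)
      (measurable_allGain_iSup fun _ _ _ _ _ _ => nofun))
    (measurable_allTau_iSup fun j s n => ⟨j, s, n, rfl⟩)

theorem indepFun_serving :
    IndepFun (fun ω => (D.allPos ω, D.allGain ω, D.allTau ω)) D.servingGain μ :=
  D.indepFun_of_sources (S := {a | a ≠ .serving}) (T := {.serving})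
    (Set.disjoint_left.2 fun _ h h' => h h')
    (Measurable.prodMk (measurable_allPos_iSup fun _ _ => nofun)
      (Measurable.prodMk (measurable_allGain_iSup fun _ _ _ => nofun)
        (measurable_allTau_iSup fun _ _ _ => nofun)))
    ((comap_measurable D.servingGain).mono
      (le_iSup₂_of_le RandomSource.serving rfl le_rfl) le_rfl)

theorem iIndepFun_pos : iIndepFun (fun (g : Fin K × CellGroup) ω n => D.pos g.1 g.2 n ω) μ :=
  D.iIndep_sourceSpace.precomp (g := fun g : Fin K × CellGroup => RandomSource.positions g.1 g.2)
    fun a b h => by cases a; cases b; cases h; rfl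

theorem iIndepFun_gain :
    iIndepFun (fun (k : (Fin K × CellGroup) × ℕ) => D.gain k.1.1 k.1.2 k.2) μ :=
  D.iIndep_sourceSpace.precomp
    (g := fun k : (Fin K × CellGroup) × ℕ => RandomSource.gain k.1.1 k.1.2 k.2)
    fun a b h => by rcases a with ⟨⟨_, _⟩, _⟩; rcases b with ⟨⟨_, _⟩, _⟩; cases h; rfl

theorem iIndepFun_tau :
    iIndepFun (fun (k : (Fin K × CellGroup) × ℕ) => D.tau k.1.1 k.1.2 k.2) μ :=
  D.iIndep_sourceSpace.precomp
    (g := fun k : (Fin K × CellGroup) × ℕ => RandomSource.indicator k.1.1 k.1.2 k.2)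
    fun a b h => by rcases a with ⟨⟨_, _⟩, _⟩; rcases b with ⟨⟨_, _⟩, _⟩; cases h; rfl

end Downlink

instance isProbabilityMeasure_rayleighLognormal (m s : ℝ) :
    IsProbabilityMeasure (rayleighLognormal m s) := by
  have := isProbabilityMeasure_expMeasure (one_pos : (0 : ℝ) < 1)
  exact Measure.isProbabilityMeasure_map (by fun_prop)

/-- The mean of `exp (-G)` over the indicator and the gain of an interferer at a given place. -/
noncomputable def SoftFRNetwork.markMean {K : ℕ} (net : SoftFRNetwork K) (j : Fin K)
    {E : Type*} (G : ℝ × ℝ × E → ℝ≥0∞) (x : E) : ℝ≥0∞ :=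
  ∫⁻ g, (ENNReal.ofReal (1 - net.eps j) * expNeg (G (0, g, x)) +
    ENNReal.ofReal (net.eps j) * expNeg (G (1, g, x))) ∂(rayleighLognormal net.muz net.sigmaz)

theorem SoftFRNetwork.measurable_markMean {K : ℕ} (net : SoftFRNetwork K) (j : Fin K)
    {E : Type*} [MeasurableSpace E] {G : ℝ × ℝ × E → ℝ≥0∞} (hG : Measurable G) :
    Measurable (net.markMean j G) := by
  refine Measurable.lintegral_prod_right' (f := fun p : E × ℝ =>
    ENNReal.ofReal (1 - net.eps j) * expNeg (G (0, p.2, p.1)) +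
      ENNReal.ofReal (net.eps j) * expNeg (G (1, p.2, p.1))) ?_
  exact ((measurable_expNeg.comp (hG.comp (by fun_prop))).const_mul _).add
    ((measurable_expNeg.comp (hG.comp (by fun_prop))).const_mul _)

theorem SoftFRNetwork.markMean_le_one {K : ℕ} (net : SoftFRNetwork K) (j : Fin K)
    {E : Type*} (G : ℝ × ℝ × E → ℝ≥0∞) (x : E) : net.markMean j G x ≤ 1 := by
  calc net.markMean j G x ≤ ∫⁻ _, 1 ∂(rayleighLognormal net.muz net.sigmaz) := by
        refine lintegral_mono fun g => ?_
        calc _ ≤ ENNReal.ofReal (1 - net.eps j) * 1 + ENNReal.ofReal (net.eps j) * 1 := by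
              gcongr <;> exact expNeg_le_one _
          _ = 1 := by
              rw [mul_one, mul_one, ← ENNReal.ofReal_add (by linarith [net.eps_le j])
                (net.eps_nonneg j)]
              simp
    _ = 1 := by simp

/-- Exponentials of truncated sums over groups converge in mean. -/
theorem tendsto_lintegral_expNeg_sum {Ω κ : Type*} [MeasurableSpace Ω] {μ : Measure Ω}
    [IsProbabilityMeasure μ] [Fintype κ] {Z : κ × ℕ → Ω → ℝ≥0∞} (hZ : ∀ k, Measurable (Z k)) :
    Tendsto (fun N => ∫⁻ ω, ∏ k ∈ Finset.univ ×ˢ Finset.range N, expNeg (Z k ω) ∂μ) atTop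
      (𝓝 (∫⁻ ω, expNeg (∑ g, ∑' n, Z (g, n) ω) ∂μ)) := by
  refine tendsto_lintegral_of_dominated_convergence (fun _ => 1) (fun N => ?_)
    (fun N => ae_of_all _ fun ω => ?_) (by simp) (ae_of_all _ fun ω => ?_)
  · exact Finset.measurable_fun_prod _ fun k _ => measurable_expNeg.comp (hZ k)
  · exact Finset.prod_le_one' fun k _ => expNeg_le_one _
  · simp_rw [← expNeg_sum, Finset.sum_product]
    exact (continuous_expNeg.tendsto _).comp
      (tendsto_finsetSum _ fun g _ => ENNReal.summable.hasSum.tendsto_sum_nat)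

namespace Downlink

variable {K : ℕ} {net : SoftFRNetwork K} {Ω : Type*} [MeasurableSpace Ω] {μ : Measure Ω}
  [IsProbabilityMeasure μ] (D : Downlink net μ)

/-- A variable with values 0 and 1 satisfies `f τ = (1 - τ) f 0 + τ f 1`, so its mean determines its
law. -/
theorem lintegral_map_tau (j : Fin K) (s : CellGroup) (n : ℕ) {f : ℝ → ℝ≥0∞}
    (hf : Measurable f) : ∫⁻ u, f u ∂(μ.map (D.tau j s n)) =
      ENNReal.ofReal (1 - net.eps j) * f 0 + ENNReal.ofReal (net.eps j) * f 1 := by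
  have hm := D.tau_measurable j s n
  have hint : Integrable (D.tau j s n) μ := by
    refine Integrable.of_bound hm.aestronglyMeasurable 1 (ae_of_all _ fun ω => ?_)
    rcases D.tau_mem j s n ω with h | h <;> simp [h]
  have h1 : ∀ ω, f (D.tau j s n ω) = ENNReal.ofReal (1 - D.tau j s n ω) * f 0 +
      ENNReal.ofReal (D.tau j s n ω) * f 1 := fun ω => by
    rcases D.tau_mem j s n ω with h | h <;> simp [h]
  rw [lintegral_map hf hm]
  simp_rw [h1]
  rw [lintegral_add_left (by fun_prop), lintegral_mul_const _ (by fun_prop),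
    lintegral_mul_const _ (by fun_prop), ← ofReal_integral_eq_lintegral_ofReal,
    ← ofReal_integral_eq_lintegral_ofReal hint, integral_sub (integrable_const _) hint,
    D.tau_mean]
  · simp
  · exact ae_of_all _ fun ω => by rcases D.tau_mem j s n ω with h | h <;> simp [h]
  · exact (integrable_const _).sub hint
  · exact ae_of_all _ fun ω => by rcases D.tau_mem j s n ω with h | h <;> simp [h]

/-- The marks of finitely many base stations can be averaged given the positions. -/
theorem lintegral_prod_marks {G : Fin K × CellGroup → ℝ × ℝ × EuclideanSpace ℝ (Fin 2) → ℝ≥0∞}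
    (hG : ∀ g, Measurable (G g)) (S : Finset ((Fin K × CellGroup) × ℕ)) :
    ∫⁻ ω, ∏ k ∈ S, expNeg (G k.1 (D.allTau ω k, D.allGain ω k, D.allPos ω k.1 k.2)) ∂μ =
      ∫⁻ ω, ∏ k ∈ S, net.markMean k.1.1 (G k.1) (D.allPos ω k.1 k.2) ∂μ := by
  have h1 := lintegral_prod_of_indep_marks (D.measurable_allPos.prodMk D.measurable_allGain)
    (fun k : (Fin K × CellGroup) × ℕ => D.tau_measurable k.1.1 k.1.2 k.2) D.iIndepFun_tau
    D.indepFun_pos_gain_tau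
    (ψ := fun k p => expNeg (G k.1 (p.2, p.1.2 k, p.1.1 k.1 k.2)))
    (fun k => measurable_expNeg.comp ((hG k.1).comp (by fun_prop))) S
  refine h1.trans ?_
  have hm : ∀ (k : (Fin K × CellGroup) × ℕ) (p : (Fin K × CellGroup → ℕ → EuclideanSpace ℝ (Fin 2))
      × ((Fin K × CellGroup) × ℕ → ℝ)),
      Measurable fun u => expNeg (G k.1 (u, p.2 k, p.1 k.1 k.2)) := fun k p =>
    measurable_expNeg.comp ((hG k.1).comp (by fun_prop))
  simp_rw [fun (k : (Fin K × CellGroup) × ℕ) ω =>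
    D.lintegral_map_tau k.1.1 k.1.2 k.2 (hm k (D.allPos ω, D.allGain ω))]
  have h2 := lintegral_prod_of_indep_marks D.measurable_allPos
    (fun k : (Fin K × CellGroup) × ℕ => D.gain_measurable k.1.1 k.1.2 k.2) D.iIndepFun_gain
    D.indepFun_pos_gain
    (ψ := fun k p => ENNReal.ofReal (1 - net.eps k.1.1) * expNeg (G k.1 (0, p.2, p.1 k.1 k.2)) +
      ENNReal.ofReal (net.eps k.1.1) * expNeg (G k.1 (1, p.2, p.1 k.1 k.2)))
    (fun k => ((measurable_expNeg.comp ((hG k.1).comp (by fun_prop))).const_mul _).add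
      ((measurable_expNeg.comp ((hG k.1).comp (by fun_prop))).const_mul _)) S
  refine h2.trans ?_
  simp_rw [D.gain_law]
  rfl

/-- The Laplace functional of the network of marked base stations. -/
theorem lintegral_expNeg_sum_tsum
    {G : Fin K × CellGroup → ℝ × ℝ × EuclideanSpace ℝ (Fin 2) → ℝ≥0∞}
    (hG : ∀ g, Measurable (G g)) :
    ∫⁻ ω, expNeg (∑ g, ∑' n, G g (D.tau g.1 g.2 n ω, D.gain g.1 g.2 n ω, D.pos g.1 g.2 n ω)) ∂μ =
      ∏ g : Fin K × CellGroup, expNeg (ENNReal.ofReal (net.density g.1 g.2) *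
        ∫⁻ x, (1 - net.markMean g.1 (G g) x)) := by
  -- With the cost `-log` of the averaged mark factor, the averaged product over points is again an
  -- exponential functional, now of the positions only.
  set F : Fin K × CellGroup → EuclideanSpace ℝ (Fin 2) → ℝ≥0∞ := fun g x =>
    (-ENNReal.log (net.markMean g.1 (G g) x)).toENNReal
  have hF : ∀ g x, expNeg (F g x) = net.markMean g.1 (G g) x := fun g x =>
    expNeg_toENNReal_neg_log (net.markMean_le_one g.1 (G g) x)
  have hFm : ∀ g, Measurable (F g) := fun g =>
    measurable_ereal_toENNReal.comp (ENNReal.measurable_log.comp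
      (net.measurable_markMean g.1 (hG g))).neg
  have hpos := fun (g : Fin K × CellGroup) n => (D.pos_poisson g.1 g.2).measurable n
  -- The marks are averaged on finitely many points only; the marked and the averaged truncations
  -- agree for each `N`, hence so do their limits.
  have h1 := tendsto_lintegral_expNeg_sum (μ := μ)
    (Z := fun (k : (Fin K × CellGroup) × ℕ) ω =>
      G k.1 (D.tau k.1.1 k.1.2 k.2 ω, D.gain k.1.1 k.1.2 k.2 ω, D.pos k.1.1 k.1.2 k.2 ω))
    fun k => (hG k.1).comp ((D.tau_measurable _ _ _).prodMk
      ((D.gain_measurable _ _ _).prodMk (hpos k.1 k.2)))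
  have h2 := tendsto_lintegral_expNeg_sum (μ := μ)
    (Z := fun (k : (Fin K × CellGroup) × ℕ) ω => F k.1 (D.pos k.1.1 k.1.2 k.2 ω))
    fun k => (hFm k.1).comp (hpos k.1 k.2)
  have h3 : ∀ N, ∫⁻ ω, ∏ k ∈ Finset.univ ×ˢ Finset.range N,
      expNeg (G k.1 (D.tau k.1.1 k.1.2 k.2 ω, D.gain k.1.1 k.1.2 k.2 ω,
        D.pos k.1.1 k.1.2 k.2 ω)) ∂μ =
      ∫⁻ ω, ∏ k ∈ Finset.univ ×ˢ Finset.range N, expNeg (F k.1 (D.pos k.1.1 k.1.2 k.2 ω)) ∂μ :=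
    fun N => by
      simp_rw [hF]
      exact D.lintegral_prod_marks hG _
  rw [tendsto_nhds_unique (h1.congr h3) h2]
  simp_rw [expNeg_sum]
  have hmeas : ∀ g, Measurable fun x : ℕ → EuclideanSpace ℝ (Fin 2) =>
      expNeg (∑' n, F g (x n)) := fun g => measurable_expNeg.comp
    (Measurable.tsum fun n => (hFm g).comp (measurable_pi_apply n))
  rw [lintegral_prod_eq_prod_lintegral_of_indepFun Finset.univ
    (fun (g : Fin K × CellGroup) ω => expNeg (∑' n, F g (D.pos g.1 g.2 n ω)))
    (D.iIndepFun_pos.comp _ hmeas) fun g => (hmeas g).comp (D.measurable_posSeq g)]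
  refine Finset.prod_congr rfl fun g _ => ?_
  -- A finite multiple of Lebesgue measure is σ-finite; the scalar is read as a nonnegative real to
  -- make its finiteness visible.
  have : SigmaFinite (ENNReal.ofReal (net.density g.1 g.2) •
      (volume : Measure (EuclideanSpace ℝ (Fin 2)))) :=
    inferInstanceAs (SigmaFinite ((Real.toNNReal (net.density g.1 g.2)) •
      (volume : Measure (EuclideanSpace ℝ (Fin 2)))))
  rw [(D.pos_poisson g.1 g.2).lintegral_expNeg_tsum (hFm g), lintegral_smul_measure, smul_eq_mul]
  simp_rw [hF]

end Downlink

/-! ### Tail and Laplace transform of the Rayleigh–lognormal law -/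

theorem lintegral_expMeasure_one (f : ℝ → ℝ≥0∞) :
    ∫⁻ x, f x ∂(expMeasure 1) = ∫⁻ x in Set.Ioi (0 : ℝ), ENNReal.ofReal (Real.exp (-x)) * f x := by
  have h1 : expMeasure 1 = (volume.restrict (Set.Ici (0 : ℝ))).withDensity
      fun x => ENNReal.ofReal (Real.exp (-x)) := by
    rw [← withDensity_indicator measurableSet_Ici]
    refine congrArg volume.withDensity (funext fun x => ?_)
    change exponentialPDF 1 x = _
    rw [exponentialPDF_eq]
    by_cases hx : 0 ≤ x
    · simp [hx]
    · simp [hx]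
  rw [h1, lintegral_withDensity_eq_lintegral_mul_non_measurable _ (by fun_prop)
    (ae_of_all _ fun x => ENNReal.ofReal_lt_top), restrict_Ioi_eq_restrict_Ici]
  rfl

theorem lintegral_Ioi_exp_neg (c : ℝ) :
    ∫⁻ x in Set.Ioi c, ENNReal.ofReal (Real.exp (-x)) = ENNReal.ofReal (Real.exp (-c)) := by
  rw [← ofReal_integral_eq_lintegral_ofReal, integral_exp_neg_Ioi]
  · refine Integrable.of_integral_ne_zero ?_
    rw [integral_exp_neg_Ioi]
    exact (Real.exp_pos _).ne'
  · exact ae_of_all _ fun x => (Real.exp_pos _).le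

/-- Tail of the exponential law. -/
theorem expMeasure_one_tail (a : ℝ≥0∞) :
    ∫⁻ x, (if a ≤ ENNReal.ofReal x then 1 else 0) ∂(expMeasure 1) = expNeg a := by
  rw [lintegral_expMeasure_one]
  by_cases ha : a = ∞
  · simp [ha, expNeg_top]
  obtain ⟨c, hc, rfl⟩ : ∃ c : ℝ, 0 ≤ c ∧ a = ENNReal.ofReal c :=
    ⟨a.toReal, ENNReal.toReal_nonneg, (ENNReal.ofReal_toReal ha).symm⟩
  rw [expNeg_ofReal hc, ← lintegral_Ioi_exp_neg c, restrict_Ioi_eq_restrict_Ici (a := c),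
    ← lintegral_indicator measurableSet_Ici, ← lintegral_indicator measurableSet_Ioi]
  refine lintegral_congr_ae ?_
  -- The two integrands differ at `x = 0` when `c = 0`, so this null point is discarded.
  filter_upwards [(measure_singleton (0 : ℝ) : (volume : Measure ℝ) {0} = 0) |>
    compl_mem_ae_iff.2] with x hx
  by_cases h0 : 0 < x
  · rw [Set.indicator_of_mem (Set.mem_Ioi.2 h0)]
    by_cases hcx : c ≤ x
    · rw [Set.indicator_of_mem (Set.mem_Ici.2 hcx), if_pos (ENNReal.ofReal_le_ofReal hcx), mul_one]
    · rw [Set.indicator_of_notMem (by simpa using hcx), if_neg (by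
        rw [ENNReal.ofReal_le_ofReal_iff h0.le]; exact hcx), mul_zero]
  · have h1 : x < 0 := lt_of_le_of_ne (not_lt.1 h0) hx
    rw [Set.indicator_of_notMem (by simpa using h1.le), Set.indicator_of_notMem (by
      simp; linarith)]

/-- Laplace transform of the exponential law. -/
theorem lintegral_expNeg_expMeasure_one {c : ℝ} (hc : 0 ≤ c) :
    ∫⁻ x, expNeg (ENNReal.ofReal (c * x)) ∂(expMeasure 1) = ENNReal.ofReal (1 / (1 + c)) := by
  rw [lintegral_expMeasure_one]
  have hneg : -(1 + c) < 0 := by linarith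
  have h1 : ∀ x ∈ Set.Ioi (0 : ℝ), ENNReal.ofReal (Real.exp (-x)) *
      expNeg (ENNReal.ofReal (c * x)) = ENNReal.ofReal (Real.exp (-(1 + c) * x)) := fun x hx => by
    rw [expNeg_ofReal (mul_nonneg hc (le_of_lt hx)), ← ENNReal.ofReal_mul (Real.exp_pos _).le,
      ← Real.exp_add]
    congr 2
    ring
  have h2 : ∫ x in Set.Ioi (0 : ℝ), Real.exp (-(1 + c) * x) = 1 / (1 + c) := by
    rw [integral_exp_mul_Ioi hneg, mul_zero, Real.exp_zero, neg_div_neg_eq]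
  rw [setLIntegral_congr_fun measurableSet_Ioi h1, ← h2, ofReal_integral_eq_lintegral_ofReal]
  · refine Integrable.of_integral_ne_zero ?_
    rw [h2]
    positivity
  · exact ae_of_all _ fun x => (Real.exp_pos _).le

/-- Under `S = √2 s t + m`, variance 1/2 for `t` gives variance `s²` for `S`; this is the
Gauss–Hermite normalisation of the shadowing. -/
theorem gaussianReal_eq_map_half (m s : ℝ) :
    gaussianReal m (Real.toNNReal (s ^ 2)) =
      (gaussianReal 0 (1 / 2)).map fun t => √2 * s * t + m := by
  have h1 : (fun t => √2 * s * t + m) = (fun x => x + m) ∘ fun t => √2 * s * t := rfl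
  rw [h1, ← Measure.map_map (by fun_prop) (by fun_prop), gaussianReal_map_const_mul,
    gaussianReal_map_add_const]
  congr 1
  · simp
  · ext
    rw [Real.coe_toNNReal _ (sq_nonneg s)]
    push_cast
    rw [mul_pow, Real.sq_sqrt (by norm_num)]
    ring

theorem lintegral_rayleighLognormal (m s : ℝ) {f : ℝ → ℝ≥0∞} (hf : Measurable f) :
    ∫⁻ g, f g ∂(rayleighLognormal m s) =
      ∫⁻ t, ∫⁻ e, f (e * shadowGain m s t) ∂(expMeasure 1) ∂(gaussianReal 0 (1 / 2)) := by
  have := isProbabilityMeasure_expMeasure (one_pos : (0 : ℝ) < 1)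
  have h1 : Measurable fun p : ℝ × ℝ => p.1 * (10 : ℝ) ^ (p.2 / 10) := by fun_prop
  have h2 : Measurable fun p : ℝ × ℝ => f (p.1 * (10 : ℝ) ^ (p.2 / 10)) := hf.comp h1
  rw [rayleighLognormal, lintegral_map hf h1, lintegral_prod_symm _ h2.aemeasurable, gaussianReal_eq_map_half, lintegral_map]
  · rfl
  · exact h2.lintegral_prod_left'
  · fun_prop

/-- Probability that a Rayleigh–lognormal gain exceeds a multiple of a given power. -/
theorem rayleighLognormal_tail (m s : ℝ) {T c : ℝ} (hc : 0 < c) (J : ℝ≥0∞) :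
    rayleighLognormal m s {g | ENNReal.ofReal T ≤ ENNReal.ofReal (c * g) / J} =
      ∫⁻ t, expNeg (ENNReal.ofReal (T / (c * shadowGain m s t)) * J)
        ∂(gaussianReal 0 (1 / 2)) := by
  have hm : MeasurableSet {g | ENNReal.ofReal T ≤ ENNReal.ofReal (c * g) / J} :=
    measurableSet_le measurable_const (by fun_prop)
  rw [← lintegral_indicator_one hm, lintegral_rayleighLognormal _ _ (measurable_one.indicator hm)]
  refine lintegral_congr fun t => ?_
  rw [← expMeasure_one_tail, lintegral_expMeasure_one, lintegral_expMeasure_one]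
  refine setLIntegral_congr_fun measurableSet_Ioi fun e he => ?_
  have he : 0 < e := he
  have hγ := SoftFRNetwork.shadowGain_pos m s t
  have hcg : 0 < c * shadowGain m s t := mul_pos hc hγ
  -- Since `e > 0`, the numerator is positive and finite, so the division can be cleared even when
  -- `J` is 0 or `∞`.
  have h1 : ENNReal.ofReal T ≤ ENNReal.ofReal (c * (e * shadowGain m s t)) / J ↔
      ENNReal.ofReal (T / (c * shadowGain m s t)) * J ≤ ENNReal.ofReal e := by
    rw [ENNReal.le_div_iff_mul_le (Or.inr (ENNReal.ofReal_pos.2 (by positivity)).ne')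
      (Or.inr ENNReal.ofReal_ne_top), show c * (e * shadowGain m s t) =
      (c * shadowGain m s t) * e by ring, ENNReal.ofReal_mul hcg.le, ENNReal.ofReal_div_of_pos hcg,
      ENNReal.mul_div_right_comm.symm, ENNReal.div_le_iff_le_mul
      (Or.inl (ENNReal.ofReal_pos.2 hcg).ne') (Or.inl ENNReal.ofReal_ne_top),
      mul_comm (ENNReal.ofReal e)]
  simp only [Set.indicator_apply, Set.mem_ofPred_eq, Pi.one_apply, h1]

/-- Laplace transform of the Rayleigh–lognormal law. -/
theorem lintegral_expNeg_rayleighLognormal (m s : ℝ) {c : ℝ} (hc : 0 ≤ c) :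
    ∫⁻ g, expNeg (ENNReal.ofReal (c * g)) ∂(rayleighLognormal m s) =
      ∫⁻ t, ENNReal.ofReal (1 / (1 + c * shadowGain m s t)) ∂(gaussianReal 0 (1 / 2)) := by
  rw [lintegral_rayleighLognormal _ _ (f := fun g => expNeg (ENNReal.ofReal (c * g)))
    (measurable_expNeg.comp (by fun_prop))]
  refine lintegral_congr fun t => ?_
  have hγ := SoftFRNetwork.shadowGain_pos m s t
  rw [← lintegral_expNeg_expMeasure_one (by positivity)]
  refine lintegral_congr fun e => ?_
  congr 2
  ring

/-! ### Radial integrals over the plane -/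

section Radial

variable {β C : ℝ}

/-- Write the integrand as `∫ C exp (-(C + v^β) y) dy` and exchange the integrals. The `v`-integral
gives `Γ(1/β + 1)`, the `y`-integral `Γ(1 - 1/β)`, and the reflection formula finishes. The
condition `β > 1` makes the second Gamma integral converge. -/
theorem lintegral_div_add_rpow (hβ : 1 < β) (hC : 0 < C) :
    ∫⁻ v in Set.Ioi (0 : ℝ), ENNReal.ofReal (C / (C + v ^ β)) =
      ENNReal.ofReal (C ^ (1 / β) * (1 / β) * (Real.pi / Real.sin (Real.pi / β))) := by
  have hβ0 : 0 < β := by linarith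
  have hb1 : 1 / β < 1 := (div_lt_one hβ0).2 hβ
  have hΓ1 : 0 < Real.Gamma (1 / β + 1) := Real.Gamma_pos_of_pos (by positivity)
  have hΓ2 : 0 < Real.Gamma (1 - 1 / β) := Real.Gamma_pos_of_pos (by linarith)
  have h1 : ∀ v ∈ Set.Ioi (0 : ℝ), ENNReal.ofReal (C / (C + v ^ β)) =
      ∫⁻ y in Set.Ioi (0 : ℝ), ENNReal.ofReal (C * Real.exp (-(C + v ^ β) * y)) := fun v hv => by
    have hv0 : 0 < C + v ^ β := by
      have := Real.rpow_pos_of_pos hv β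
      linarith
    have h2 : ∫ y in Set.Ioi (0 : ℝ), C * Real.exp (-(C + v ^ β) * y) = C / (C + v ^ β) := by
      rw [integral_const_mul, integral_exp_mul_Ioi (by linarith), mul_zero, Real.exp_zero,
        neg_div_neg_eq, mul_one_div]
    rw [← h2, ofReal_integral_eq_lintegral_ofReal]
    · refine Integrable.of_integral_ne_zero ?_
      rw [h2]
      positivity
    · exact ae_of_all _ fun y => by positivity
  rw [setLIntegral_congr_fun measurableSet_Ioi h1, lintegral_lintegral_swap (by
    refine Measurable.aemeasurable ?_
    unfold Function.uncurry
    fun_prop)]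
  have h3 : ∀ y ∈ Set.Ioi (0 : ℝ),
      ∫⁻ v in Set.Ioi (0 : ℝ), ENNReal.ofReal (C * Real.exp (-(C + v ^ β) * y)) =
      ENNReal.ofReal (C * Real.Gamma (1 / β + 1) *
        (y ^ ((1 - 1 / β) - 1) * Real.exp (-(C * y)))) := fun y hy => by
    have hy0 : 0 < y := hy
    have h4 : ∫ v in Set.Ioi (0 : ℝ), C * Real.exp (-(C + v ^ β) * y) =
        C * Real.Gamma (1 / β + 1) * (y ^ ((1 - 1 / β) - 1) * Real.exp (-(C * y))) := by
      have h5 : ∀ v : ℝ, C * Real.exp (-(C + v ^ β) * y) =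
          C * Real.exp (-(C * y)) * Real.exp (-y * v ^ β) := fun v => by
        rw [mul_assoc, ← Real.exp_add]
        congr 2
        ring
      simp_rw [h5]
      rw [integral_const_mul, integral_exp_neg_mul_rpow hβ0 hy0]
      have : (1 - 1 / β) - 1 = -1 / β := by ring
      rw [this]
      ring
    rw [← h4, ofReal_integral_eq_lintegral_ofReal]
    · refine Integrable.of_integral_ne_zero ?_
      rw [h4]
      positivity
    · exact ae_of_all _ fun y => by positivity
  have h6 : ∫ y in Set.Ioi (0 : ℝ), C * Real.Gamma (1 / β + 1) *
      (y ^ ((1 - 1 / β) - 1) * Real.exp (-(C * y))) =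
      C ^ (1 / β) * (1 / β) * (Real.pi / Real.sin (Real.pi / β)) := by
    rw [integral_const_mul, Real.integral_rpow_mul_exp_neg_mul_Ioi (by linarith) hC]
    have h7 : (1 / C) ^ (1 - 1 / β) = C ^ (1 / β) / C := by
      rw [one_div, Real.inv_rpow hC.le, ← Real.rpow_neg hC.le, neg_sub, Real.rpow_sub hC,
        Real.rpow_one]
    have h8 := Real.Gamma_mul_Gamma_one_sub (1 / β)
    rw [h7, Real.Gamma_add_one (by positivity), ← mul_one_div Real.pi β, ← h8]
    field_simp
  rw [setLIntegral_congr_fun measurableSet_Ioi h3, ← h6, ofReal_integral_eq_lintegral_ofReal]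
  · refine Integrable.of_integral_ne_zero ?_
    rw [integral_const_mul, Real.integral_rpow_mul_exp_neg_mul_Ioi (by linarith) hC]
    have : 0 < (1 / C) ^ (1 - 1 / β) := Real.rpow_pos_of_pos (by positivity) _
    positivity
  · refine (ae_restrict_mem measurableSet_Ioi).mono fun y hy => ?_
    have : 0 ≤ y ^ ((1 - 1 / β) - 1) := Real.rpow_nonneg (le_of_lt hy) _
    simp only [Pi.zero_apply]
    positivity

theorem integrableOn_div_add_rpow (hβ : 1 < β) (hC : 0 < C) :
    IntegrableOn (fun v : ℝ => C / (C + v ^ β)) (Set.Ioi 0) := by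
  refine ⟨Measurable.aestronglyMeasurable (by fun_prop), ?_⟩
  rw [hasFiniteIntegral_iff_norm]
  have h : ∀ v ∈ Set.Ioi (0 : ℝ), ENNReal.ofReal ‖C / (C + v ^ β)‖ =
      ENNReal.ofReal (C / (C + v ^ β)) := fun v hv => by
    rw [Real.norm_of_nonneg (div_add_mem_Icc hC (Real.rpow_nonneg (le_of_lt hv) _)).1]
  rw [setLIntegral_congr_fun measurableSet_Ioi h, lintegral_div_add_rpow hβ hC]
  exact ENNReal.ofReal_lt_top

theorem integral_Ioi_div_add_rpow (hβ : 1 < β) (hC : 0 < C) :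
    ∫ v in Set.Ioi (0 : ℝ), C / (C + v ^ β) =
      C ^ (1 / β) * (1 / β) * (Real.pi / Real.sin (Real.pi / β)) := by
  have hβ0 : 0 < β := by linarith
  have hs : 0 < Real.sin (Real.pi / β) := Real.sin_pos_of_pos_of_lt_pi (by positivity)
    (div_lt_self Real.pi_pos hβ)
  have h0 : 0 ≤ᵐ[volume.restrict (Set.Ioi (0 : ℝ))] fun v : ℝ => C / (C + v ^ β) :=
    (ae_restrict_mem measurableSet_Ioi).mono fun v hv =>
      (div_add_mem_Icc hC (Real.rpow_nonneg (le_of_lt hv) _)).1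
  rw [integral_eq_lintegral_of_nonneg_ae h0
    (Measurable.aestronglyMeasurable (by fun_prop)), lintegral_div_add_rpow hβ hC,
    ENNReal.toReal_ofReal]
  positivity

theorem integral_Ioi_one_div_add_rpow (hβ : 1 < β) (hC : 0 < C) :
    ∫ v in Set.Ioi (1 : ℝ), C / (C + v ^ β) =
      C ^ (1 / β) * (1 / β) * (Real.pi / Real.sin (Real.pi / β)) -
        ∫ u in (0 : ℝ)..1, C / (C + u ^ β) := by
  have hi := integrableOn_div_add_rpow hβ hC
  rw [← integral_Ioi_div_add_rpow hβ hC, intervalIntegral.integral_of_le zero_le_one,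
    eq_sub_iff_add_eq, add_comm, ← setIntegral_union (Set.Ioc_disjoint_Ioi le_rfl)
      measurableSet_Ioi (hi.mono_set Set.Ioc_subset_Ioi_self)
      (hi.mono_set (Set.Ioi_subset_Ioi zero_le_one)), Set.Ioc_union_Ioi_eq_Ioi zero_le_one]

end Radial

/-- Integration of a function of `‖x‖ ^ 2` over the plane. -/
theorem integral_plane_norm_sq (g : ℝ → ℝ) :
    ∫ x : EuclideanSpace ℝ (Fin 2), g (‖x‖ ^ 2) = Real.pi * ∫ u in Set.Ioi (0 : ℝ), g u := by
  rw [integral_fun_norm_addHaar volume fun y => g (y ^ 2), ← integral_comp_rpow_Ioi_of_pos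
    (g := g) (two_pos : (0 : ℝ) < 2)]
  have h1 : (volume : Measure (EuclideanSpace ℝ (Fin 2))).real (Metric.ball 0 1) = Real.pi := by
    rw [measureReal_def, EuclideanSpace.volume_ball_fin_two]
    simp [Real.pi_pos.le]
  rw [h1, finrank_euclideanSpace_fin, nsmul_eq_mul, smul_eq_mul, mul_left_comm,
    ← integral_const_mul]
  congr 1
  refine setIntegral_congr_fun measurableSet_Ioi fun y _ => ?_
  norm_num
  ring

theorem integrable_plane_norm_sq {g : ℝ → ℝ} (hg : IntegrableOn g (Set.Ioi 0)) :
    Integrable fun x : EuclideanSpace ℝ (Fin 2) => g (‖x‖ ^ 2) := by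
  rw [integrable_fun_norm_addHaar volume (f := fun y => g (y ^ 2))]
  have h1 := (((integrableOn_Ioi_comp_rpow_iff g (two_ne_zero : (2 : ℝ) ≠ 0)).2 hg).const_mul
    (1 / 2))
  refine IntegrableOn.congr_fun h1 (fun y _ => ?_) measurableSet_Ioi
  norm_num
  ring

/-- The substitution `v = ‖x‖² / r²` carries the area to `π r² dv` and turns `b / (b + ‖x‖^α)` into
`C / (C + v^(α/2))` with `C = b r^(-α)`. -/
theorem lintegral_plane_outside {α b r : ℝ} (hα : 2 < α) (hb : 0 < b) (hr : 0 < r) :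
    ∫⁻ x : EuclideanSpace ℝ (Fin 2),
      (if r ≤ ‖x‖ then ENNReal.ofReal (b / (b + ‖x‖ ^ α)) else 0) =
    ENNReal.ofReal (Real.pi * r ^ 2 * ∫ v in Set.Ioi (1 : ℝ),
      b * r ^ (-α) / (b * r ^ (-α) + v ^ (α / 2))) := by
  set C := b * r ^ (-α) with hC
  have hrα : 0 < r ^ α := Real.rpow_pos_of_pos hr _
  have hC0 : 0 < C := by
    have := Real.rpow_pos_of_pos hr (-α)
    positivity
  set h : ℝ → ℝ := (Set.Ioi (1 : ℝ)).indicator fun v => C / (C + v ^ (α / 2)) with hh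
  have hβ : 1 < α / 2 := by linarith
  have hint : IntegrableOn h (Set.Ioi 0) := by
    refine Integrable.integrableOn ?_
    rw [hh, integrable_indicator_iff measurableSet_Ioi]
    exact (integrableOn_div_add_rpow hβ hC0).mono_set (Set.Ioi_subset_Ioi zero_le_one)
  have hr2 : 0 < (r ^ 2)⁻¹ := by positivity
  have hg : IntegrableOn (fun u => h ((r ^ 2)⁻¹ * u)) (Set.Ioi 0) := by
    rw [integrableOn_Ioi_comp_mul_left_iff h 0 hr2, mul_zero]
    exact hint
  have hI : ∫ x : EuclideanSpace ℝ (Fin 2), h ((r ^ 2)⁻¹ * ‖x‖ ^ 2) =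
      Real.pi * r ^ 2 * ∫ v in Set.Ioi (1 : ℝ), C / (C + v ^ (α / 2)) := by
    rw [integral_plane_norm_sq fun u => h ((r ^ 2)⁻¹ * u), integral_comp_mul_left_Ioi h 0 hr2,
      mul_zero, inv_inv, smul_eq_mul, mul_assoc, hh, setIntegral_indicator measurableSet_Ioi,
      Set.inter_eq_self_of_subset_right (Set.Ioi_subset_Ioi zero_le_one)]
  have h0 : ∀ v, 0 ≤ h v := fun v => Set.indicator_nonneg (fun v hv =>
    (div_add_mem_Icc hC0 (Real.rpow_nonneg (zero_le_one.trans (le_of_lt hv)) _)).1) v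
  rw [← hI, ofReal_integral_eq_lintegral_ofReal (integrable_plane_norm_sq hg)
    (ae_of_all _ fun x => h0 _)]
  -- The cutoff is `r ≤ ‖x‖` on one side and `1 < v` on the other; they differ only on the null
  -- circle `‖x‖ = r`.
  have hsphere : ∀ᵐ x : EuclideanSpace ℝ (Fin 2), ‖x‖ ≠ r := by
    have := Measure.addHaar_sphere (volume : Measure (EuclideanSpace ℝ (Fin 2))) 0 r
    filter_upwards [compl_mem_ae_iff.2 this] with x hx
    simpa using hx
  refine lintegral_congr_ae (hsphere.mono fun x hx => ?_)
  dsimp only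
  have hiff : r < ‖x‖ ↔ 1 < (r ^ 2)⁻¹ * ‖x‖ ^ 2 := by
    rw [inv_mul_eq_div, one_lt_div (by positivity), sq_lt_sq₀ hr.le (norm_nonneg x)]
  by_cases hrx : r ≤ ‖x‖
  · have hlt : r < ‖x‖ := lt_of_le_of_ne hrx hx.symm
    rw [if_pos hrx, hh, Set.indicator_of_mem (Set.mem_Ioi.2 (hiff.1 hlt))]
    congr 1
    have h1 : ((r ^ 2)⁻¹ * ‖x‖ ^ 2) ^ (α / 2) = r ^ (-α) * ‖x‖ ^ α := by
      rw [Real.mul_rpow hr2.le (by positivity), ← Real.rpow_natCast, ← Real.rpow_natCast,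
        ← Real.rpow_neg hr.le, ← Real.rpow_mul hr.le, ← Real.rpow_mul (norm_nonneg x)]
      congr 2
      · push_cast; ring
      · push_cast; ring
    rw [h1, hC, ← mul_div_mul_right b _ (Real.rpow_pos_of_pos hr (-α)).ne']
    congr 1
    ring
  · rw [if_neg hrx, hh, Set.indicator_of_notMem, ENNReal.ofReal_zero]
    intro h1
    exact hrx (hiff.2 h1).le

/-! ### The exponent contributed by one group of base stations -/

namespace SoftFRNetwork

variable {K : ℕ} (net : SoftFRNetwork K) (i j : Fin K) {T r q : ℝ}

/-- The exponent of a group in the conditional Laplace functional, per interferer at a place `x`: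
infinite within distance `r`, and `c` times the received power elsewhere. -/
noncomputable def interferenceCost (j : Fin K) (q r c : ℝ)
    (p : ℝ × ℝ × EuclideanSpace ℝ (Fin 2)) : ℝ≥0∞ :=
  (if ‖p.2.2‖ < r then ∞ else 0) + ENNReal.ofReal c *
    ENNReal.ofReal (p.1 * (q * net.P j) * p.2.1 * ‖p.2.2‖ ^ (-net.alpha j))

theorem measurable_interferenceCost (q r c : ℝ) : Measurable (net.interferenceCost j q r c) := by
  refine Measurable.add (Measurable.ite (measurableSet_lt (by fun_prop) (by fun_prop))
    measurable_const measurable_const) (Measurable.const_mul ?_ _)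
  fun_prop

/-- With `β = α / 2`, the sines agree because `π (α - 2) / α = π - π / β`. -/
theorem integral_Ioi_one_eq_mainTerm_sub {C : ℝ} (hC : 0 < C) :
    ∫ v in Set.Ioi (1 : ℝ), C / (C + v ^ (net.alpha j / 2)) =
      net.mainTerm j C - net.nearRatio j C := by
  have hα := net.alpha_gt j
  have hα0 : net.alpha j ≠ 0 := by linarith
  rw [integral_Ioi_one_div_add_rpow (by linarith) hC, nearRatio, mainTerm, one_div_div]
  have h1 : Real.sin (Real.pi * (net.alpha j - 2) / net.alpha j) =
      Real.sin (Real.pi / (net.alpha j / 2)) := by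
    rw [← Real.sin_pi_sub]
    congr 1
    field_simp
    ring
  rw [h1]
  congr 1
  ring

/-- Inside the ball the infinite cost makes the mean 0. Outside, only an occupied cell costs
anything, and exponential fading averages to `1 / (1 + d γ(t))`, whose complement is the ratio on
the right. -/
theorem one_sub_markMean_interferenceCost (hq : 0 < q) {c : ℝ} (hc : 0 < c) (hr : 0 < r)
    (x : EuclideanSpace ℝ (Fin 2)) :
    1 - net.markMean j (net.interferenceCost j q r c) x =
      (Metric.ball (0 : EuclideanSpace ℝ (Fin 2)) r).indicator 1 x +
      ENNReal.ofReal (net.eps j) * ∫⁻ t, (if r ≤ ‖x‖ then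
        ENNReal.ofReal (c * q * net.P j * shadowGain net.muz net.sigmaz t /
          (c * q * net.P j * shadowGain net.muz net.sigmaz t + ‖x‖ ^ net.alpha j)) else 0)
        ∂(gaussianReal 0 (1 / 2)) := by
  by_cases hx : ‖x‖ < r
  · have h1 : net.markMean j (net.interferenceCost j q r c) x = 0 := by
      simp [markMean, interferenceCost, hx, expNeg_top]
    rw [h1, Set.indicator_of_mem (by simpa using hx)]
    simp [not_le.2 hx]
  have hx' : r ≤ ‖x‖ := not_lt.1 hx
  have hx0 : 0 < ‖x‖ := hr.trans_le hx'
  have hP := net.P_pos j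
  have hxα : 0 < ‖x‖ ^ (-net.alpha j) := Real.rpow_pos_of_pos hx0 _
  have hxα' : 0 < ‖x‖ ^ net.alpha j := Real.rpow_pos_of_pos hx0 _
  rw [Set.indicator_of_notMem (by simpa using hx'), zero_add]
  simp only [if_pos hx']
  set d := c * (q * net.P j) * ‖x‖ ^ (-net.alpha j) with hd
  have hd0 : 0 < d := by positivity
  have h1 : net.markMean j (net.interferenceCost j q r c) x = ENNReal.ofReal (1 - net.eps j) +
      ENNReal.ofReal (net.eps j) * ∫⁻ t, ENNReal.ofReal
        (1 / (1 + d * shadowGain net.muz net.sigmaz t)) ∂(gaussianReal 0 (1 / 2)) := by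
    have h2 : ∀ g : ℝ, expNeg (net.interferenceCost j q r c (1, g, x)) =
        expNeg (ENNReal.ofReal (d * g)) := fun g => by
      simp only [interferenceCost, if_neg hx, zero_add]
      rw [← ENNReal.ofReal_mul hc.le]
      congr 2
      rw [hd]
      ring
    have h3 : ∀ g : ℝ, expNeg (net.interferenceCost j q r c (0, g, x)) = 1 := fun g => by
      simp [interferenceCost, if_neg hx, expNeg_zero]
    have hm : Measurable fun g : ℝ => expNeg (ENNReal.ofReal (d * g)) :=
      measurable_expNeg.comp (by fun_prop)
    simp only [markMean, h2, h3, mul_one]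
    rw [lintegral_add_left measurable_const, lintegral_const, measure_univ, mul_one,
      lintegral_const_mul _ hm,
      lintegral_expNeg_rayleighLognormal _ _ hd0.le]
  have h4 : ∀ t, c * q * net.P j * shadowGain net.muz net.sigmaz t /
      (c * q * net.P j * shadowGain net.muz net.sigmaz t + ‖x‖ ^ net.alpha j) =
      1 - 1 / (1 + d * shadowGain net.muz net.sigmaz t) := fun t => by
    have hγ := shadowGain_pos net.muz net.sigmaz t
    rw [hd, Real.rpow_neg hx0.le]
    field_simp
    ring
  have hmeas : Measurable fun t => ENNReal.ofReal
      (1 / (1 + d * shadowGain net.muz net.sigmaz t)) := by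
    have := (continuous_shadowGain net.muz net.sigmaz).measurable
    fun_prop
  have h5 : (∫⁻ t, ENNReal.ofReal (1 - 1 / (1 + d * shadowGain net.muz net.sigmaz t))
      ∂(gaussianReal 0 (1 / 2))) + ∫⁻ t, ENNReal.ofReal
      (1 / (1 + d * shadowGain net.muz net.sigmaz t)) ∂(gaussianReal 0 (1 / 2)) = 1 := by
    rw [← lintegral_add_right _ hmeas]
    refine (lintegral_congr fun t => ?_).trans (by simp : ∫⁻ _, 1 ∂(gaussianReal 0 (1 / 2)) = 1)
    have hγ := shadowGain_pos net.muz net.sigmaz t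
    have h6 : 1 / (1 + d * shadowGain net.muz net.sigmaz t) ≤ 1 :=
      (div_le_one (by positivity)).2 (by nlinarith [mul_pos hd0 hγ])
    rw [← ENNReal.ofReal_add (by linarith) (by positivity)]
    simp
  simp_rw [h4]
  refine ENNReal.sub_eq_of_eq_add (ne_top_of_le_ne_top ENNReal.one_ne_top
    (net.markMean_le_one j _ x)) ?_
  rw [h1, add_left_comm, ← mul_add, h5, mul_one, ← ENNReal.ofReal_add
    (by linarith [net.eps_le j]) (net.eps_nonneg j)]
  simp

theorem mainTerm_sub_nearRatio_nonneg {C : ℝ} (hC : 0 < C) :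
    0 ≤ net.mainTerm j C - net.nearRatio j C := by
  rw [← net.integral_Ioi_one_eq_mainTerm_sub j hC]
  exact setIntegral_nonneg measurableSet_Ioi fun v hv =>
    (div_add_mem_Icc hC (Real.rpow_nonneg (zero_le_one.trans (le_of_lt hv)) _)).1

theorem fI_nonneg (hT : 0 < T) (hr : 0 < r) (hq : 0 < q) (t : ℝ) : 0 ≤ net.fI i j T r q t := by
  rw [fI_eq_integral]
  exact integral_nonneg fun s => net.mainTerm_sub_nearRatio_nonneg j (net.cFactor_pos i j hT hr hq t s)

theorem volume_ball_plane (hr : 0 < r) :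
    volume (Metric.ball (0 : EuclideanSpace ℝ (Fin 2)) r) = ENNReal.ofReal (Real.pi * r ^ 2) := by
  rw [EuclideanSpace.volume_ball_fin_two, ← ENNReal.ofReal_pow hr.le, mul_comm,
    ← ENNReal.ofReal_mul Real.pi_pos.le]

/-- The rate `T r ^ α / (γ(t) φ P)` at which interference power enters the conditional coverage
probability. -/
noncomputable def servingRate (i : Fin K) (T r t : ℝ) : ℝ :=
  T / (net.phi i * net.P i * r ^ (-net.alpha i) * shadowGain net.muz net.sigmaz t)

theorem servingRate_pos (hT : 0 < T) (hr : 0 < r) (t : ℝ) : 0 < net.servingRate i T r t := by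
  have h1 := shadowGain_pos net.muz net.sigmaz t
  have h2 := net.P_pos i
  have h3 := net.phi_pos i
  have h4 := Real.rpow_pos_of_pos hr (-net.alpha i)
  unfold servingRate
  positivity

/-- The ball contributes its area, the summand 1. Outside, Tonelli and the radial integral apply for
each shadowing value `s`, and the serving rate is such that the resulting constant is exactly
`cFactor`. -/
theorem lintegral_one_sub_markMean (hT : 0 < T) (hr : 0 < r) (hq : 0 < q) (t : ℝ) :
    ∫⁻ x, (1 - net.markMean j (net.interferenceCost j q r (net.servingRate i T r t)) x) =
      ENNReal.ofReal (Real.pi * r ^ 2 * (1 + net.eps j * net.fI i j T r q t)) := by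
  have hc := net.servingRate_pos i hT hr t
  have hP := net.P_pos j
  have hγc := (continuous_shadowGain net.muz net.sigmaz).measurable
  simp_rw [fun x => net.one_sub_markMean_interferenceCost j hq hc hr x]
  have hmeas : Measurable (Function.uncurry fun (x : EuclideanSpace ℝ (Fin 2)) (s : ℝ) =>
      if r ≤ ‖x‖ then ENNReal.ofReal (net.servingRate i T r t * q * net.P j *
        shadowGain net.muz net.sigmaz s / (net.servingRate i T r t * q * net.P j *
          shadowGain net.muz net.sigmaz s + ‖x‖ ^ net.alpha j)) else 0) := by
    refine Measurable.ite (measurableSet_le (by fun_prop) (by fun_prop)) ?_ measurable_const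
    fun_prop
  have hmeas1 := hmeas.lintegral_prod_right' (ν := gaussianReal 0 (1 / 2))
  simp only [Function.uncurry] at hmeas1
  rw [lintegral_add_left (measurable_one.indicator measurableSet_ball),
    lintegral_indicator_one measurableSet_ball, volume_ball_plane hr,
    lintegral_const_mul _ hmeas1, lintegral_lintegral_swap hmeas.aemeasurable]
  have h1 : ∀ s, net.servingRate i T r t * q * net.P j * shadowGain net.muz net.sigmaz s *
      r ^ (-net.alpha j) = net.cFactor i j T r q t s := fun s => by
    have h1 := shadowGain_pos net.muz net.sigmaz t
    have h2 := net.P_pos i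
    have h3 := net.phi_pos i
    have h4 := Real.rpow_pos_of_pos hr (net.alpha i)
    rw [servingRate, cFactor, sub_eq_add_neg, Real.rpow_add hr, Real.rpow_neg hr.le (net.alpha i)]
    field_simp
  have h2 : ∀ s, 0 < net.servingRate i T r t * q * net.P j * shadowGain net.muz net.sigmaz s :=
    fun s => by
      have := shadowGain_pos net.muz net.sigmaz s
      positivity
  simp_rw [fun s => lintegral_plane_outside (net.alpha_gt j) (h2 s) hr, h1,
    fun s => net.integral_Ioi_one_eq_mainTerm_sub j (net.cFactor_pos i j hT hr hq t s)]
  rw [← ofReal_integral_eq_lintegral_ofReal, integral_const_mul, ← fI_eq_integral,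
    ← ENNReal.ofReal_mul (net.eps_nonneg j), ← ENNReal.ofReal_add (by positivity)]
  · congr 1
    ring
  · have := net.fI_nonneg i j hT hr hq t
    have := net.eps_nonneg j
    positivity
  · exact ((net.integrable_mainTerm i j hT hr hq t).sub
      (net.integrable_nearRatio i j hT hr hq t)).const_mul _
  · exact ae_of_all _ fun s => mul_nonneg (by positivity)
      (net.mainTerm_sub_nearRatio_nonneg j (net.cFactor_pos i j hT hr hq t s))

/-- At rate 0 only the exclusion of the ball remains; this case yields the probability of the
conditioning event. -/
theorem lintegral_one_sub_markMean_zero (hr : 0 < r) :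
    ∫⁻ x, (1 - net.markMean j (net.interferenceCost j q r 0) x) =
      ENNReal.ofReal (Real.pi * r ^ 2) := by
  rw [← volume_ball_plane hr, ← lintegral_indicator_one measurableSet_ball]
  refine lintegral_congr fun x => ?_
  by_cases hx : ‖x‖ < r
  · have h1 : net.markMean j (net.interferenceCost j q r 0) x = 0 := by
      simp [markMean, interferenceCost, hx, expNeg_top]
    rw [h1, Set.indicator_of_mem (by simpa using hx), tsub_zero, Pi.one_apply]
  · have h1 : net.markMean j (net.interferenceCost j q r 0) x = 1 := by
      simp only [markMean, interferenceCost, if_neg hx, ENNReal.ofReal_zero, zero_mul, add_zero,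
        expNeg_zero, mul_one, lintegral_const, measure_univ]
      rw [← ENNReal.ofReal_add (by linarith [net.eps_le j]) (net.eps_nonneg j)]
      simp
    rw [h1, Set.indicator_of_notMem (by simpa using not_lt.1 hx), tsub_self]

end SoftFRNetwork

/-! ### The conditional coverage probability -/

theorem CellGroup.sum_eq {M : Type*} [AddCommMonoid M] (f : CellGroup → M) :
    ∑ s, f s = f .center + f .edge :=
  Finset.sum_pair (by decide)

namespace Downlink

variable {K : ℕ} {net : SoftFRNetwork K} {Ω : Type*} [MeasurableSpace Ω] {μ : Measure Ω}
  (D : Downlink net μ) (i : Fin K) {T r : ℝ}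

theorem interference_eq_sum (ω : Ω) : D.interference ω =
    ∑ g : Fin K × CellGroup, D.groupInterference g.1 g.2 ω := by
  simp_rw [Fintype.sum_prod_type, CellGroup.sum_eq, Finset.sum_add_distrib]
  rfl

theorem measurableSet_nearestAt (r : ℝ) : MeasurableSet (D.nearestAt r) := by
  have h : D.nearestAt r = ⋂ g : Fin K × CellGroup, ⋂ n, {ω | r ≤ ‖D.pos g.1 g.2 n ω‖} := by
    ext ω
    simp [nearestAt]
  rw [h]
  exact MeasurableSet.iInter fun g => MeasurableSet.iInter fun n =>
    measurableSet_le measurable_const ((D.pos_poisson g.1 g.2).measurable n).norm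

/-- One point at distance less than `r` makes the total cost infinite and the exponential 0; this is
how the conditioning event enters the Laplace functional. -/
theorem expNeg_sum_interferenceCost (r c : ℝ) (ω : Ω) :
    expNeg (∑ g : Fin K × CellGroup, ∑' n, net.interferenceCost g.1 (net.ratio g.1 g.2) r c
      (D.tau g.1 g.2 n ω, D.gain g.1 g.2 n ω, D.pos g.1 g.2 n ω)) =
    (D.nearestAt r).indicator (fun ω => expNeg (ENNReal.ofReal c * D.interference ω)) ω := by
  have h1 : ∑ g : Fin K × CellGroup, ∑' n, net.interferenceCost g.1 (net.ratio g.1 g.2) r c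
      (D.tau g.1 g.2 n ω, D.gain g.1 g.2 n ω, D.pos g.1 g.2 n ω) =
      (∑ g : Fin K × CellGroup, ∑' n, if ‖D.pos g.1 g.2 n ω‖ < r then ∞ else 0) +
        ENNReal.ofReal c * D.interference ω := by
    rw [interference_eq_sum, Finset.mul_sum, ← Finset.sum_add_distrib]
    refine Finset.sum_congr rfl fun g _ => ?_
    rw [groupInterference, ← ENNReal.tsum_mul_left, ← ENNReal.tsum_add]
    rfl
  rw [h1]
  by_cases hω : ω ∈ D.nearestAt r
  · rw [Set.indicator_of_mem hω]
    have h2 : ∀ (g : Fin K × CellGroup) n,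
        (if ‖D.pos g.1 g.2 n ω‖ < r then ∞ else 0 : ℝ≥0∞) = 0 := fun g n =>
      if_neg (not_lt.2 (hω g.1 g.2 n))
    simp [h2]
  · rw [Set.indicator_of_notMem hω]
    obtain ⟨j, s, n, hn⟩ : ∃ j s n, ‖D.pos j s n ω‖ < r := by
      simpa [nearestAt] using hω
    have h2 : ∑ g : Fin K × CellGroup, ∑' n, (if ‖D.pos g.1 g.2 n ω‖ < r then ∞ else 0) = ∞ := by
      refine ENNReal.sum_eq_top.2 ⟨(j, s), Finset.mem_univ _, ?_⟩
      exact ENNReal.tsum_eq_top_of_eq_top ⟨n, if_pos hn⟩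
    rw [h2, top_add, expNeg_top]

/-- Values of all positions, gains and indicators. -/
abbrev Environment (K : ℕ) : Type :=
  (Fin K × CellGroup → ℕ → EuclideanSpace ℝ (Fin 2)) ×
    ((Fin K × CellGroup) × ℕ → ℝ) × ((Fin K × CellGroup) × ℕ → ℝ)

/-- The interference as a function of all positions, gains and indicators. -/
noncomputable def interferenceOf (net : SoftFRNetwork K) (v : Environment K) : ℝ≥0∞ :=
  ∑ g : Fin K × CellGroup, ∑' n, ENNReal.ofReal (v.2.2 (g, n) * (net.ratio g.1 g.2 * net.P g.1) *
    v.2.1 (g, n) * ‖v.1 g n‖ ^ (-net.alpha g.1))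

theorem measurable_interferenceOf (net : SoftFRNetwork K) : Measurable (interferenceOf net) := by
  refine Finset.measurable_fun_sum _ fun g _ => Measurable.tsum fun n => ?_
  fun_prop

theorem interferenceOf_eq (ω : Ω) :
    interferenceOf net (D.allPos ω, D.allGain ω, D.allTau ω) = D.interference ω := by
  rw [interference_eq_sum]
  rfl

theorem measurable_interference : Measurable D.interference := by
  simp_rw [funext fun ω => (D.interferenceOf_eq ω).symm]
  exact (measurable_interferenceOf net).comp
    (D.measurable_allPos.prodMk (D.measurable_allGain.prodMk D.measurable_allTau))

variable [IsProbabilityMeasure μ]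

theorem lintegral_indicator_expNeg_interference (r c : ℝ) :
    ∫⁻ ω, (D.nearestAt r).indicator
        (fun ω => expNeg (ENNReal.ofReal c * D.interference ω)) ω ∂μ =
      ∏ g : Fin K × CellGroup, expNeg (ENNReal.ofReal (net.density g.1 g.2) *
        ∫⁻ x, (1 - net.markMean g.1
          (net.interferenceCost g.1 (net.ratio g.1 g.2) r c) x)) := by
  simp_rw [← D.expNeg_sum_interferenceCost]
  exact D.lintegral_expNeg_sum_tsum fun g => net.measurable_interferenceCost g.1 _ r c

theorem measure_nearestAt (hr : 0 < r) : μ (D.nearestAt r) =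
    expNeg (∑ g : Fin K × CellGroup,
      ENNReal.ofReal (net.density g.1 g.2 * (Real.pi * r ^ 2))) := by
  have h1 := D.lintegral_indicator_expNeg_interference r 0
  simp only [ENNReal.ofReal_zero, zero_mul, expNeg_zero] at h1
  rw [expNeg_sum, ← lintegral_indicator_one (D.measurableSet_nearestAt r)]
  refine h1.trans (Finset.prod_congr rfl fun g _ => ?_)
  rw [net.lintegral_one_sub_markMean_zero g.1 hr, ENNReal.ofReal_mul (net.density_pos _ _).le]

/-- In each group the exponent splits into `λ π r²` and `π r² ε λ f`. The first parts multiply to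
the probability of the conditioning event, the second to the interference factor; the noise is
deterministic and factors out. -/
theorem lintegral_nearestAt_expNeg_servingRate (hT : 0 < T) (hr : 0 < r) (t : ℝ) :
    ∫⁻ ω, (D.nearestAt r).indicator (fun ω => expNeg (ENNReal.ofReal (net.servingRate i T r t) *
        (D.interference ω + ENNReal.ofReal net.noise))) ω ∂μ =
      μ (D.nearestAt r) *
        ENNReal.ofReal (net.coverageTerm i T r t fun j q => net.fI i j T r q t) := by
  have hc := net.servingRate_pos i hT hr t
  have h1 : ∀ ω, (D.nearestAt r).indicator
      (fun ω => expNeg (ENNReal.ofReal (net.servingRate i T r t) *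
        (D.interference ω + ENNReal.ofReal net.noise))) ω =
      ENNReal.ofReal (Real.exp (-(net.servingRate i T r t * net.noise))) *
        (D.nearestAt r).indicator (fun ω => expNeg
          (ENNReal.ofReal (net.servingRate i T r t) * D.interference ω)) ω := fun ω => by
    by_cases hω : ω ∈ D.nearestAt r
    · rw [Set.indicator_of_mem hω, Set.indicator_of_mem hω, mul_add, expNeg_add, mul_comm,
        ← ENNReal.ofReal_mul hc.le, expNeg_ofReal (mul_nonneg hc.le net.noise_nonneg)]
    · rw [Set.indicator_of_notMem hω, Set.indicator_of_notMem hω, mul_zero]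
  simp_rw [h1]
  rw [lintegral_const_mul' _ _ ENNReal.ofReal_ne_top, D.lintegral_indicator_expNeg_interference,
    D.measure_nearestAt hr]
  have hd := fun g : Fin K × CellGroup => (net.density_pos g.1 g.2).le
  have hf : ∀ g : Fin K × CellGroup, 0 ≤ Real.pi * r ^ 2 * (net.eps g.1 *
      (net.density g.1 g.2 * net.fI i g.1 T r (net.ratio g.1 g.2) t)) := fun g => by
    have h2 := net.fI_nonneg i g.1 hT hr (net.ratio_pos g.1 g.2) t
    have h3 := net.eps_nonneg g.1
    have h4 := hd g
    positivity
  have h2 : ∀ g : Fin K × CellGroup, expNeg (ENNReal.ofReal (net.density g.1 g.2) *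
      ∫⁻ x, (1 - net.markMean g.1 (net.interferenceCost g.1 (net.ratio g.1 g.2) r
        (net.servingRate i T r t)) x)) =
      expNeg (ENNReal.ofReal (net.density g.1 g.2 * (Real.pi * r ^ 2))) *
      expNeg (ENNReal.ofReal (Real.pi * r ^ 2 * (net.eps g.1 *
        (net.density g.1 g.2 * net.fI i g.1 T r (net.ratio g.1 g.2) t)))) := fun g => by
    have h4 := hd g
    rw [net.lintegral_one_sub_markMean i g.1 hT hr (net.ratio_pos g.1 g.2), ← expNeg_add,
      ← ENNReal.ofReal_mul h4, ← ENNReal.ofReal_add (by positivity) (hf g)]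
    congr 2
    ring
  simp_rw [h2]
  rw [Finset.prod_mul_distrib, ← expNeg_sum, ← expNeg_sum, mul_left_comm,
    ← ENNReal.ofReal_sum_of_nonneg fun g _ => hf g,
    expNeg_ofReal (Finset.sum_nonneg fun g _ => hf g), ← ENNReal.ofReal_mul (Real.exp_pos _).le,
    SoftFRNetwork.coverageTerm]
  -- This also holds for zero noise: then `snr` is 0 by the convention for division by zero, and so
  -- is `1 / (φ * snr)`.
  have h3 : net.servingRate i T r t * net.noise = T * r ^ net.alpha i /
      shadowGain net.muz net.sigmaz t * (1 / (net.phi i * net.snr i)) := by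
    rw [SoftFRNetwork.servingRate, SoftFRNetwork.snr, Real.rpow_neg hr.le]
    simp only [mul_inv, div_eq_mul_inv, inv_inv]
    ring
  have h4 : ∑ g : Fin K × CellGroup, Real.pi * r ^ 2 * (net.eps g.1 *
      (net.density g.1 g.2 * net.fI i g.1 T r (net.ratio g.1 g.2) t)) =
      Real.pi * r ^ 2 * ∑ j, net.eps j * (net.density j .center * net.fI i j T r 1 t +
        net.density j .edge * net.fI i j T r (net.phi j) t) := by
    rw [← Finset.mul_sum, Fintype.sum_prod_type]
    simp_rw [CellGroup.sum_eq, mul_add]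
    rfl
  rw [h3, h4]

/-- Integrating out the gain of the serving link. -/
theorem measure_nearestAt_inter_covered (T : ℝ) (hr : 0 < r) :
    μ (D.nearestAt r ∩ {ω | ENNReal.ofReal T ≤ D.sinr i r ω}) =
      ∫⁻ ω, ∫⁻ t, (D.nearestAt r).indicator (fun ω =>
        expNeg (ENNReal.ofReal (net.servingRate i T r t) *
          (D.interference ω + ENNReal.ofReal net.noise))) ω ∂(gaussianReal 0 (1 / 2)) ∂μ := by
  set c := net.phi i * net.P i * r ^ (-net.alpha i) with hc
  have hc0 : 0 < c := mul_pos (mul_pos (net.phi_pos i) (net.P_pos i))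
    (Real.rpow_pos_of_pos hr _)
  -- The event is the preimage of a product-measurable set under the environment and the serving
  -- gain, so by independence the gain can be integrated out with the environment fixed.
  let S₁ : Set (Environment K × ℝ) := {p | ∀ g n, r ≤ ‖p.1.1 g n‖}
  let S₂ : Set (Environment K × ℝ) := {p | ENNReal.ofReal T ≤
    ENNReal.ofReal (c * p.2) / (interferenceOf net p.1 + ENNReal.ofReal net.noise)}
  let S := S₁ ∩ S₂
  have hS₁ : MeasurableSet S₁ := by
    have : S₁ = ⋂ g, ⋂ n, {p | r ≤ ‖p.1.1 g n‖} := by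
      ext p
      simp [S₁]
    rw [this]
    exact MeasurableSet.iInter fun g => MeasurableSet.iInter fun n =>
      measurableSet_le measurable_const (by fun_prop)
  have hS₂ : MeasurableSet S₂ := by
    have hI := measurable_interferenceOf net
    exact measurableSet_le measurable_const (by fun_prop)
  have hS : MeasurableSet S := hS₁.inter hS₂
  have hmem : ∀ ω ω', ((D.allPos ω, D.allGain ω, D.allTau ω), D.servingGain ω') ∈ S ↔
      ω ∈ D.nearestAt r ∧ ENNReal.ofReal T ≤ ENNReal.ofReal (c * D.servingGain ω') /
        (D.interference ω + ENNReal.ofReal net.noise) := fun ω ω' => by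
    rw [← D.interferenceOf_eq]
    exact and_congr_left fun _ => by simp [nearestAt, allPos, S₁]
  have hset : D.nearestAt r ∩ {ω | ENNReal.ofReal T ≤ D.sinr i r ω} =
      (fun ω => ((D.allPos ω, D.allGain ω, D.allTau ω), D.servingGain ω)) ⁻¹' S := by
    ext ω
    rw [Set.mem_preimage, hmem, Set.mem_inter_iff, Set.mem_ofPred_eq, sinr, hc,
      mul_right_comm (net.phi i * net.P i)]
  have hV : Measurable fun ω => (D.allPos ω, D.allGain ω, D.allTau ω) :=
    D.measurable_allPos.prodMk (D.measurable_allGain.prodMk D.measurable_allTau)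
  have hF := (measurable_one (α := ℝ≥0∞)).indicator hS
  have h1 := D.indepFun_serving.lintegral_eq_lintegral_lintegral hV D.servingGain_measurable hF
  rw [hset, ← lintegral_indicator_one (hS.preimage (hV.prodMk D.servingGain_measurable))]
  refine h1.trans (lintegral_congr fun ω => ?_)
  by_cases hω : ω ∈ D.nearestAt r
  · simp only [Set.indicator_of_mem hω]
    have h2 := rayleighLognormal_tail net.muz net.sigmaz (T := T) hc0
      (D.interference ω + ENNReal.ofReal net.noise)
    have hm : MeasurableSet {g | ENNReal.ofReal T ≤ ENNReal.ofReal (c * g) /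
        (D.interference ω + ENNReal.ofReal net.noise)} :=
      measurableSet_le measurable_const (by fun_prop)
    rw [← D.servingGain_law, Measure.map_apply D.servingGain_measurable hm,
      ← lintegral_indicator_one (D.servingGain_measurable hm)] at h2
    refine (lintegral_congr fun ω' => ?_).trans h2
    exact Set.indicator_eq_indicator ((hmem ω ω').trans (and_iff_right hω)) rfl
  · simp_rw [fun f : Ω → ℝ≥0∞ => Set.indicator_of_notMem hω f, lintegral_zero]
    refine (lintegral_congr fun ω' => Set.indicator_of_notMem ?_ _).trans lintegral_zero
    exact fun h => hω ((hmem ω ω').1 h).1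

/-- Exchanging the integrals fixes `t` while the network is averaged. The probability of the
conditioning event then factors out of the `t`-integral and cancels. -/
theorem coverage_eq_coverageExact (hT : 0 < T) (hr : 0 < r) :
    D.coverage i T r = net.coverageExact i T r := by
  have hγ := (SoftFRNetwork.continuous_shadowGain net.muz net.sigmaz).measurable
  have hrate : Measurable fun t => net.servingRate i T r t := by
    unfold SoftFRNetwork.servingRate
    fun_prop
  have hA := D.measurableSet_nearestAt r
  have hswap : AEMeasurable (Function.uncurry fun (ω : Ω) (t : ℝ) =>
      (D.nearestAt r).indicator (fun ω => expNeg (ENNReal.ofReal (net.servingRate i T r t) *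
        (D.interference ω + ENNReal.ofReal net.noise))) ω)
      (μ.prod (gaussianReal 0 (1 / 2))) := by
    have hI := D.measurable_interference
    have h1 : Measurable fun p : Ω × ℝ => expNeg (ENNReal.ofReal (net.servingRate i T r p.2) *
        (D.interference p.1 + ENNReal.ofReal net.noise)) :=
      measurable_expNeg.comp (by fun_prop)
    exact (h1.indicator (hA.preimage measurable_fst)).aemeasurable
  have hterm : Measurable fun t => net.coverageTerm i T r t fun j q => net.fI i j T r q t := by
    have hf := fun j q => net.measurable_fI i j T r q
    unfold SoftFRNetwork.coverageTerm
    fun_prop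
  -- The cancellation needs the conditioning event to have positive probability; that probability is
  -- the exponential of a finite number.
  have hA0 : μ (D.nearestAt r) ≠ 0 := by
    rw [D.measure_nearestAt hr, ← ENNReal.ofReal_sum_of_nonneg fun g _ => ?_, expNeg_ofReal]
    · exact (ENNReal.ofReal_pos.2 (Real.exp_pos _)).ne'
    · exact Finset.sum_nonneg fun g _ => mul_nonneg (net.density_pos _ _).le (by positivity)
    · exact mul_nonneg (net.density_pos _ _).le (by positivity)
  rw [coverage, measureReal_def, cond_apply hA, D.measure_nearestAt_inter_covered i T hr,
    lintegral_lintegral_swap hswap]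
  simp_rw [D.lintegral_nearestAt_expNeg_servingRate i hT hr]
  rw [lintegral_const_mul _ (by fun_prop), ← mul_assoc,
    ENNReal.inv_mul_cancel hA0 (measure_ne_top _ _), one_mul, SoftFRNetwork.coverageExact,
    integral_exp_neg_sq_div_mul, integral_eq_lintegral_of_nonneg_ae _ hterm.aestronglyMeasurable]
  refine ae_of_all _ fun t => ?_
  simp only [SoftFRNetwork.coverageTerm, Pi.zero_apply]
  positivity

end Downlink

theorem lemma1 {K : ℕ} (net : SoftFRNetwork K) {Ω : Type*} [MeasurableSpace Ω]
    (μ : Measure Ω) [IsProbabilityMeasure μ] (D : Downlink net μ)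
    (i : Fin K) (T r : ℝ) (hT : 0 < T) (hr : 0 < r) :
    D.coverage i T r = net.coverageExact i T r ∧
    ∀ (a w x c : (N : ℕ) → Fin N → ℝ),
      (∀ N, IsGaussRule hermiteMeasure (a N) (w N)) →
      (∀ N, IsGaussRule legendreMeasure (x N) (c N)) →
      Tendsto (fun N : ℕ × ℕ => net.coverageQuad (a N.1) (w N.1) (x N.2) (c N.2) i T r)
        (atTop ×ˢ atTop) (𝓝 (D.coverage i T r)) := by
  have h := D.coverage_eq_coverageExact i hT hr
  refine ⟨h, fun a w x c hG hL => ?_⟩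
  rw [h]
  exact net.tendsto_coverageQuad i hG hL hT hr
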